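/- Let $G$ be a non-discrete, compactly generated, topologically simple, totally disconnected, locally compact group (topologically simple means that the only closed normal subgroups are the trivial one and $G$). A locally normal subgroup of $G$ is a compact subgroup whose normaliser is open. Let $\mathcal{LN}(G)$ be the set of commensurability classes $[H]$ of locally normal subgroups $H$, ordered by $\alpha\le\beta$ if $H\le K$ for some $H\in\alpha$ and $K\in\beta$, on which $G$ acts by conjugation, $g[H]=[gHg^{-1}]$; let $0$ be the class of the trivial subgroup, $\infty$ the class of the compact open subgroups, and $\mathcal{LN}(G)^G$ the set of $G$-fixed elements. Then: (i) For each $\alpha\in\mathcal{LN}(G)$ there exist $n\ge 1$ and $g_1,\dots,g_n\in G$ such that the join (least upper bound) $g_1\alpha\vee\dots\vee g_n\alpha$ exists and is fixed by $G$. (ii) If $\mathcal{LN}(G)^G=\{0,\infty\}$, then every compact subgroup $K$ of $G$ that is commensurated by $G$ (that is, $gKg^{-1}$ and $K$ are commensurate for all $g\in G$) is either finite or open. (iii) If $G$ is abstractly simple, then $\mathcal{LN}(G)^G=\{0,\infty\}$. (iv) Assume that $G$ is compactly presented, that is, $G$ has a presentation $\langle S\mid R\rangle$ with $S$ a compact subset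 of $G$ and with relators of uniformly bounded word length with respect to $S$. If $G$ is abstractly perfect (equal to its abstract commutator subgroup), or if some compact open subgroup $U$ of $G$ is such that $U/\overline{[U,U]}$ is finite, then $\mathcal{LN}(G)^G=\{0,\infty\}$. -/

import Mathlib

open scoped Pointwise

namespace TDLC

/-- The class `𝒮` of non-discrete, compactly generated, topologically simple, totally
disconnected, locally compact groups. (A totally disconnected topological group is Hausdorff.) -/
class IsClassS (G : Type*) [Group G] [TopologicalSpace G] : Prop extends
    IsTopologicalGroup G, LocallyCompactSpace G, TotallyDisconnectedSpace G where
  not_discrete : ¬ DiscreteTopology G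
  compactly_generated : ∃ S : Set G, IsCompact S ∧ Subgroup.closure S = ⊤
  topologically_simple :
    ∀ N : Subgroup G, N.Normal → IsClosed (N : Set G) → N = ⊥ ∨ N = ⊤

/-- `G` is compactly presented: it has a presentation `⟨S | R⟩` where `S` is a compact subset of
`G` and the relators in `R` have uniformly bounded word length with respect to `S`. An element of
the free group on `S` has length at most `n` when it is represented by a word in the letters
`s, s⁻¹` (`s ∈ S`) with at most `n` letters. -/
def IsCompactlyPresented (G : Type*) [Group G] [TopologicalSpace G] : Prop :=
  ∃ (S : Set G) (R : Set (FreeGroup S)) (n : ℕ),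
    IsCompact S ∧
    (∀ r ∈ R, ∃ w : List (S × Bool), w.length ≤ n ∧ FreeGroup.mk w = r) ∧
    Function.Surjective (FreeGroup.lift (fun s : S => (s : G))) ∧
    (FreeGroup.lift (fun s : S => (s : G))).ker = Subgroup.normalClosure R

/-- A locally normal subgroup: a compact subgroup whose normalizer is open. -/
structure LocallyNormal (G : Type*) [Group G] [TopologicalSpace G] where
  toSubgroup : Subgroup G
  isCompact : IsCompact (toSubgroup : Set G)
  isOpen_normalizer : IsOpen (Subgroup.normalizer (toSubgroup : Set G) : Set G)

section

variable {G : Type*} [Group G] [TopologicalSpace G]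

/-- Commensurability of locally normal subgroups. -/
instance LocallyNormal.setoid : Setoid (LocallyNormal G) where
  r H K := Subgroup.Commensurable H.toSubgroup K.toSubgroup
  iseqv := ⟨fun _ => .refl _, fun h => h.symm, fun h h' => h.trans h'⟩

end

/-- The structure lattice `LN(G)`: commensurability classes of locally normal subgroups. -/
def StructureLattice (G : Type*) [Group G] [TopologicalSpace G] : Type _ :=
  Quotient (LocallyNormal.setoid (G := G))

namespace StructureLattice

section

variable {G : Type*} [Group G] [TopologicalSpace G]

/-- The class `[H]` of a locally normal subgroup `H`. -/
def mk (H : LocallyNormal G) : StructureLattice G := Quotient.mk _ H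

theorem mk_eq_mk {H K : LocallyNormal G} :
    mk H = mk K ↔ Subgroup.Commensurable H.toSubgroup K.toSubgroup :=
  Quotient.eq (r := LocallyNormal.setoid)

theorem exists_rep (α : StructureLattice G) : ∃ H, mk H = α := Quotient.exists_rep α

/-- `α ≤ β` if some representative of `α` is contained in some representative of `β`. -/
instance : LE (StructureLattice G) where
  le α β := ∃ H K : LocallyNormal G, mk H = α ∧ mk K = β ∧ H.toSubgroup ≤ K.toSubgroup

variable [IsTopologicalGroup G]

/-- In a Hausdorff group, `[H] ≤ [K]` if and only if `H ∩ K` has finite index in `H`. -/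
theorem mk_le_mk [T2Space G] {H K : LocallyNormal G} :
    mk H ≤ mk K ↔ K.toSubgroup.relIndex H.toSubgroup ≠ 0 := by
  constructor
  · rintro ⟨H', K', hH, hK, hle⟩
    rw [mk_eq_mk] at hH hK
    have h1 : K'.toSubgroup.relIndex H'.toSubgroup ≠ 0 := by
      rw [Subgroup.relIndex_eq_one.mpr hle]
      exact one_ne_zero
    exact Subgroup.relIndex_ne_zero_trans hK.2 (Subgroup.relIndex_ne_zero_trans h1 hH.1)
  · intro h
    refine ⟨⟨H.toSubgroup ⊓ K.toSubgroup, ?_, ?_⟩, K, ?_, rfl, inf_le_right⟩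
    · exact H.isCompact.inter K.isCompact
    · refine Subgroup.isOpen_mono
        (H₁ := Subgroup.normalizer (H.toSubgroup : Set G) ⊓
          Subgroup.normalizer (K.toSubgroup : Set G)) ?_
        (H.isOpen_normalizer.inter K.isOpen_normalizer)
      intro g hg n
      exact and_congr (hg.1 n) (hg.2 n)
    · rw [mk_eq_mk]
      refine ⟨?_, ?_⟩
      · rw [Subgroup.inf_relIndex_left]
        exact h
      · rw [Subgroup.relIndex_eq_one.mpr inf_le_left]
        exact one_ne_zero

instance [T2Space G] : PartialOrder (StructureLattice G) where
  le_refl α := by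
    obtain ⟨H, rfl⟩ := exists_rep α
    exact ⟨H, H, rfl, rfl, le_rfl⟩
  le_trans α β γ := by
    obtain ⟨H, rfl⟩ := exists_rep α
    obtain ⟨K, rfl⟩ := exists_rep β
    obtain ⟨L, rfl⟩ := exists_rep γ
    rw [mk_le_mk, mk_le_mk, mk_le_mk]
    exact fun h h' => Subgroup.relIndex_ne_zero_trans h' h
  le_antisymm α β := by
    obtain ⟨H, rfl⟩ := exists_rep α
    obtain ⟨K, rfl⟩ := exists_rep β
    rw [mk_le_mk, mk_le_mk, mk_eq_mk]
    exact fun h h' => ⟨h', h⟩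

end

section

theorem coe_conj_smul {G : Type*} [Group G] (g : G) (H : Subgroup G) :
    ((ConjAct.toConjAct g • H : Subgroup G) : Set G) = (fun x => g * x * g⁻¹) '' H := by
  rw [Subgroup.coe_pointwise_smul]
  rfl

variable {G : Type*} [Group G] [TopologicalSpace G] [IsTopologicalGroup G]

/-- The conjugate `g H g⁻¹` of a locally normal subgroup `H`. -/
def conj (g : G) (H : LocallyNormal G) : LocallyNormal G where
  toSubgroup := ConjAct.toConjAct g • H.toSubgroup
  isCompact := by
    rw [coe_conj_smul]
    exact H.isCompact.image (by fun_prop)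
  isOpen_normalizer := by
    have h : IsOpen ((fun x : G => g⁻¹ * x * g) ⁻¹'
        (Subgroup.normalizer (H.toSubgroup : Set G) : Set G)) :=
      H.isOpen_normalizer.preimage (by fun_prop)
    convert h using 1
    have key : ∀ n : G, n ∈ (ConjAct.toConjAct g • H.toSubgroup : Subgroup G) ↔
        g⁻¹ * n * g ∈ H.toSubgroup := by
      intro n
      rw [Subgroup.mem_pointwise_smul_iff_inv_smul_mem, ← ConjAct.toConjAct_inv,
        ConjAct.toConjAct_smul, inv_inv]
    ext x
    constructor
    · intro hx n
      have := hx (g * n * g⁻¹)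
      simp only [SetLike.mem_coe, key] at this ⊢
      convert this using 2 <;> group
    · intro hx n
      have := hx (g⁻¹ * n * g)
      simp only [SetLike.mem_coe, key] at this ⊢
      convert this using 2; group

/-- The action of `G` on `LN(G)` by conjugation: `g • [H] = [g H g⁻¹]`. -/
instance : MulAction G (StructureLattice G) where
  smul g := Quotient.map (conj g)
    (fun _ _ h => Subgroup.Commensurable.conj h (ConjAct.toConjAct g))
  one_smul α := by
    obtain ⟨H, rfl⟩ := exists_rep α
    change mk (conj 1 H) = mk H
    rw [mk_eq_mk]
    change Subgroup.Commensurable (ConjAct.toConjAct (1 : G) • H.toSubgroup) H.toSubgroup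
    rw [ConjAct.toConjAct_one, one_smul]
  mul_smul g h α := by
    obtain ⟨H, rfl⟩ := exists_rep α
    change mk (conj (g * h) H) = mk (conj g (conj h H))
    rw [mk_eq_mk]
    change Subgroup.Commensurable (ConjAct.toConjAct (g * h) • H.toSubgroup)
      (ConjAct.toConjAct g • ConjAct.toConjAct h • H.toSubgroup)
    rw [ConjAct.toConjAct_mul, mul_smul]

theorem smul_mk (g : G) (H : LocallyNormal G) : g • mk H = mk (conj g H) := rfl

/-- `0 ∈ LN(G)`, the class of the trivial subgroup. -/
instance : Zero (StructureLattice G) where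
  zero := mk
    { toSubgroup := ⊥
      isCompact := by
        rw [Subgroup.coe_bot]
        exact isCompact_singleton
      isOpen_normalizer := by
        rw [Subgroup.normalizer_eq_top]
        exact isOpen_univ }

/-- A compact open subgroup is locally normal. -/
def _root_.TDLC.LocallyNormal.ofCompactOpen (U : Subgroup G) (hc : IsCompact (U : Set G))
    (ho : IsOpen (U : Set G)) : LocallyNormal G where
  toSubgroup := U
  isCompact := hc
  isOpen_normalizer := Subgroup.isOpen_mono Subgroup.le_normalizer ho

/-- An open subgroup meets a compact subgroup in a subgroup of finite index. -/
theorem relIndex_ne_zero {U V : Subgroup G} (hU : IsOpen (U : Set G))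
    (hV : IsCompact (V : Set G)) : U.relIndex V ≠ 0 := by
  have : CompactSpace V := isCompact_iff_compactSpace.mp hV
  have h : IsOpen ((U.subgroupOf V : Subgroup V) : Set V) :=
    hU.preimage continuous_subtype_val
  have : Finite (V ⧸ U.subgroupOf V) := Subgroup.quotient_finite_of_isOpen _ h
  have hf : (U.subgroupOf V).FiniteIndex := Subgroup.finiteIndex_of_finite_quotient
  exact hf.index_ne_zero

variable [LocallyCompactSpace G] [TotallyDisconnectedSpace G]

variable (G) in
/-- A totally disconnected locally compact group has a compact open subgroup. -/
theorem exists_compactOpen :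
    ∃ U : Subgroup G, IsCompact (U : Set G) ∧ IsOpen (U : Set G) := by
  obtain ⟨K, hK, hK1⟩ := exists_compact_mem_nhds (1 : G)
  obtain ⟨W, hW, h1W, hWK⟩ :=
    (loc_compact_Haus_tot_disc_of_zero_dim (H := G)).mem_nhds_iff.mp hK1
  have hWc : IsCompact W := hK.of_isClosed_subset hW.1 hWK
  obtain ⟨T, hT, hTW⟩ := compact_open_separated_mul_left hWc hW.2 le_rfl
  have ho : IsOpen (MulAction.stabilizer G W : Set G) := by
    apply Subgroup.isOpen_of_mem_nhds (g := 1)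
    filter_upwards [hT, inv_mem_nhds_one G hT] with g hg hg'
    rw [SetLike.mem_coe, MulAction.mem_stabilizer_iff]
    apply subset_antisymm
    · rintro _ ⟨w, hw, rfl⟩
      exact hTW (Set.mul_mem_mul hg hw)
    · intro w hw
      rw [Set.mem_smul_set_iff_inv_smul_mem]
      exact hTW (Set.mul_mem_mul hg' hw)
  refine ⟨MulAction.stabilizer G W, hWc.of_isClosed_subset
    (Subgroup.isClosed_of_isOpen _ ho) ?_, ho⟩
  intro g hg
  have : g • (1 : G) ∈ g • W := Set.smul_mem_smul_set h1W
  rw [MulAction.mem_stabilizer_iff.mp hg] at this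
  simpa using this

variable (G) in
/-- `∞ ∈ LN(G)`, the class of the compact open subgroups (see `mk_ofCompactOpen`). -/
noncomputable def infty : StructureLattice G :=
  mk (LocallyNormal.ofCompactOpen (exists_compactOpen G).choose
    (exists_compactOpen G).choose_spec.1 (exists_compactOpen G).choose_spec.2)

/-- Every compact open subgroup represents `∞`. -/
theorem mk_ofCompactOpen (U : Subgroup G) (hc : IsCompact (U : Set G))
    (ho : IsOpen (U : Set G)) : mk (LocallyNormal.ofCompactOpen U hc ho) = infty G :=
  mk_eq_mk.mpr ⟨relIndex_ne_zero ho (exists_compactOpen G).choose_spec.1,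
    relIndex_ne_zero (exists_compactOpen G).choose_spec.2 hc⟩

end

end StructureLattice

end TDLC

open TDLC

/-!
Let `FinCov B A` say that the set `A` lies in finitely many left cosets of the subgroup `B`; then
`[H] ≤ [K]` means `FinCov K H`. Two locally normal subgroups normalize a common open subgroup `U`,
and `(H ∩ U)(K ∩ U)` represents the join of their classes, so finite joins exist. For a nontrivial
locally normal subgroup `H`, let `L` be its abstract normal closure, which is dense in `G`.

*Fixed joins.* A locally normal subgroup fixes every class above its own (`smul_eq_of_mem`). As `G`
is compactly generated and `L` is dense, `G` is generated by a compact open subgroup `U` and finitely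
many conjugates `g H g⁻¹`. The join of the finitely many classes in the `U`-orbits of these
`g • [H]` is fixed by `U` and by the conjugates, hence by `G`.

*Commensurated compact subgroups.* Simplicity and compact generation make `G` first countable
(`exists_seq_open_subgroups`). A Baire category argument then shows that a commensurated compact
subgroup is commensurate to a locally normal one, whose class is fixed.

*Abstractly simple groups.* If `[H]` is fixed, then `H` is commensurated and `L` is a countable
union of cosets of `H`. If `L = G`, then `H` is open by Baire category.

*Compactly presented groups.* Let `[H] ≠ 0` be fixed; one may take `H` to be a normal subgroup of a
compact open subgroup `U`. Since `G = L U`, there is a map `s ↦ u s` from the compact generating set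
to `U` with `s (u s)⁻¹ ∈ L`. Words of bounded length in the `s` and in the `u s` differ by finitely
many cosets of `H` in `L`, and each element of `L` is centralized modulo `H` by an open subgroup.
So for some open normal subgroup `V` of `U`, with centralizer `C` modulo `H`, the map `s ↦ u s` turns
the relators into elements of `C`, and induces a homomorphism from `G` to `U / C` which extends the
quotient map of `U` and so is trivial on `L`. Hence `L ∩ U ≤ C`, and by density `C = U`: the centre
of `U / H` has finite index (`finiteIndex_center_of_isCompactlyPresented`). By Schur's theorem the
commutator subgroup of `U / H` is finite. If `U / closure [U, U]` is finite, then so is `U / H`. If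
`G` is perfect, then `G / L`, a perfect quotient of `U / H`, is finite, so `H` has countable index.
In both cases `H` is open.
-/

namespace TDLC

open Subgroup hiding mk
open StructureLattice Topology Filter
open scoped commutatorElement

/-! ### Finite covers by cosets, and finite joins in the structure lattice -/

section

section Cover

variable {G : Type*} [Group G]

/-- `A` is covered by finitely many left cosets of `B`. When `A` is a subgroup, this says that
`A ∩ B` has finite index in `A`. -/
def FinCov (B : Subgroup G) (A : Set G) : Prop :=
  ∃ T : Set G, T.Finite ∧ A ⊆ T * (B : Set G)

theorem FinCov.mono {B : Subgroup G} {A A' : Set G} (h : FinCov B A) (hA : A' ⊆ A) :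
    FinCov B A' :=
  let ⟨T, hT, hs⟩ := h
  ⟨T, hT, hA.trans hs⟩

theorem FinCov.of_subset {B : Subgroup G} {A : Set G} (h : A ⊆ B) : FinCov B A :=
  ⟨{1}, Set.finite_singleton 1, by simpa using h⟩

theorem FinCov.of_finite {B : Subgroup G} {A : Set G} (h : A.Finite) : FinCov B A :=
  ⟨A, h, fun a ha => ⟨a, ha, 1, B.one_mem, mul_one a⟩⟩

theorem FinCov.exists_subset {B : Subgroup G} {A : Set G} (h : FinCov B A) :
    ∃ T : Set G, T ⊆ A ∧ T.Finite ∧ A ⊆ T * (B : Set G) := by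
  obtain ⟨T, hT, hA⟩ := h
  have hc : ∀ t : {t ∈ T | ∃ a ∈ A, t⁻¹ * a ∈ B}, ∃ a ∈ A, (t : G)⁻¹ * a ∈ B := fun t => t.2.2
  choose f hfA hfB using hc
  have : Finite {t ∈ T | ∃ a ∈ A, t⁻¹ * a ∈ B} := (hT.subset (Set.sep_subset _ _)).to_subtype
  refine ⟨Set.range f, Set.range_subset_iff.mpr hfA, Set.finite_range f, fun a ha => ?_⟩
  obtain ⟨t, ht, b, hb, rfl⟩ := hA ha
  have hta : t ∈ {t ∈ T | ∃ a ∈ A, t⁻¹ * a ∈ B} := ⟨ht, _, ha, by simpa using hb⟩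
  refine ⟨f ⟨t, hta⟩, ⟨_, rfl⟩, (f ⟨t, hta⟩)⁻¹ * (t * b), ?_, by simp⟩
  have := B.mul_mem (B.inv_mem (hfB ⟨t, hta⟩)) hb
  simpa [mul_assoc] using this

theorem FinCov.trans {B C : Subgroup G} {A : Set G} (h : FinCov B A) (h' : FinCov C (B : Set G)) :
    FinCov C A := by
  obtain ⟨T, hT, hA⟩ := h
  obtain ⟨T', hT', hB⟩ := h'
  exact ⟨T * T', hT.mul hT', hA.trans ((Set.mul_subset_mul_left hB).trans (mul_assoc _ _ _).ge)⟩

theorem FinCov.union {B : Subgroup G} {A A' : Set G} (h : FinCov B A) (h' : FinCov B A') :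
    FinCov B (A ∪ A') := by
  obtain ⟨T, hT, hA⟩ := h
  obtain ⟨T', hT', hA'⟩ := h'
  refine ⟨T ∪ T', hT.union hT', ?_⟩
  rw [Set.union_mul]
  exact Set.union_subset_union hA hA'

theorem FinCov.biUnion {ι : Type*} {I : Set ι} (hI : I.Finite) {B : Subgroup G} {A : ι → Set G}
    (h : ∀ i ∈ I, FinCov B (A i)) : FinCov B (⋃ i ∈ I, A i) := by
  induction I, hI using Set.Finite.induction_on with
  | empty => simpa using FinCov.of_finite Set.finite_empty
  | insert _ _ ih =>
    rw [Set.biUnion_insert]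
    exact (h _ (Set.mem_insert _ _)).union (ih fun i hi => h i (Set.mem_insert_of_mem _ hi))

theorem FinCov.smul {B : Subgroup G} {A : Set G} (h : FinCov B A) (g : G) : FinCov B (g • A) := by
  obtain ⟨T, hT, hA⟩ := h
  refine ⟨g • T, hT.smul_set, ?_⟩
  rw [smul_mul_assoc]
  exact Set.smul_set_mono hA

theorem FinCov.image_conj {B : Subgroup G} {A : Set G} (h : FinCov B A) (g : G) :
    FinCov (ConjAct.toConjAct g • B) ((fun x => g * x * g⁻¹) '' A) := by
  obtain ⟨T, hT, hA⟩ := h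
  refine ⟨(fun x => g * x * g⁻¹) '' T, hT.image _, ?_⟩
  rw [coe_conj_smul]
  rintro _ ⟨a, ha, rfl⟩
  obtain ⟨t, ht, b, hb, rfl⟩ := hA ha
  exact ⟨_, ⟨t, ht, rfl⟩, _, ⟨b, hb, rfl⟩, by group⟩

theorem finCov_coe_iff {A B : Subgroup G} : FinCov B (A : Set G) ↔ B.relIndex A ≠ 0 := by
  constructor
  · intro h
    obtain ⟨T, hTA, hT, hA⟩ := h.exists_subset
    have := hT.to_subtype
    have hsurj : Function.Surjective
        (fun t : T => ((⟨t, hTA t.2⟩ : A) : A ⧸ B.subgroupOf A)) := by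
      intro q
      obtain ⟨a, rfl⟩ := QuotientGroup.mk_surjective q
      obtain ⟨t, ht, b, hb, hab⟩ := hA a.2
      refine ⟨⟨t, ht⟩, ?_⟩
      rw [QuotientGroup.eq, mem_subgroupOf]
      simpa [← hab] using hb
    have := Finite.of_surjective _ hsurj
    exact (finiteIndex_of_finite_quotient (H := B.subgroupOf A)).index_ne_zero
  · intro h
    have : (B.subgroupOf A).FiniteIndex := ⟨h⟩
    have : Finite (A ⧸ B.subgroupOf A) := inferInstance
    refine ⟨Set.range fun q : A ⧸ B.subgroupOf A => (q.out : G), Set.finite_range _,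
      fun a ha => ?_⟩
    refine ⟨_, ⟨((⟨a, ha⟩ : A) : A ⧸ B.subgroupOf A), rfl⟩, _, ?_, mul_inv_cancel_left _ _⟩
    have := QuotientGroup.eq.mp (QuotientGroup.out_eq' ((⟨a, ha⟩ : A) : A ⧸ B.subgroupOf A))
    simpa [mem_subgroupOf] using this

/-- If `A` normalizes `A'`, and both are covered by finitely many cosets of `B`, then so is the
product `A * A'`. -/
theorem FinCov.mul_of_normalizes {A A' B : Subgroup G} (hn : A ≤ normalizer (A' : Set G))
    (h : FinCov B (A : Set G)) (h' : FinCov B (A' : Set G)) :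
    FinCov B ((A : Set G) * (A' : Set G)) := by
  obtain ⟨T, hTA, hT, hA⟩ := h.exists_subset
  obtain ⟨T', hT', hA'⟩ := h'
  refine ⟨T * T', hT.mul hT', ?_⟩
  rintro _ ⟨a, ha, a', ha', rfl⟩
  obtain ⟨t, ht, b, hb, rfl⟩ := hA ha
  -- `b = t⁻¹ a` lies in `A`, so it can be moved past `a'`.
  have hbA : b ∈ A := by simpa using A.mul_mem (A.inv_mem (hTA ht)) ha
  have hc : b * a' * b⁻¹ ∈ A' := (hn hbA a').mp ha'
  obtain ⟨t', ht', c, hc, hcb⟩ := hA' hc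
  refine ⟨t * t', ⟨t, ht, t', ht', rfl⟩, c * b, B.mul_mem hc hb, ?_⟩
  have : t' * c = b * a' * b⁻¹ := hcb
  calc t * t' * (c * b) = t * (t' * c) * b := by group
    _ = t * b * a' := by rw [this]; group

theorem mem_conj_smul {g x : G} {H : Subgroup G} :
    x ∈ ConjAct.toConjAct g • H ↔ g⁻¹ * x * g ∈ H := by
  rw [mem_pointwise_smul_iff_inv_smul_mem, ← ConjAct.toConjAct_inv, ConjAct.toConjAct_smul, inv_inv]

end Cover

namespace StructureLattice

variable {G : Type*} [Group G] [TopologicalSpace G] [IsTopologicalGroup G]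

theorem mk_le_mk_iff_finCov [T2Space G] {H K : LocallyNormal G} :
    mk H ≤ mk K ↔ FinCov K.toSubgroup (H.toSubgroup : Set G) := by
  rw [mk_le_mk, finCov_coe_iff]

protected theorem zero_le [T2Space G] (α : StructureLattice G) : 0 ≤ α := by
  obtain ⟨K, rfl⟩ := exists_rep α
  exact mk_le_mk_iff_finCov.mpr (.of_subset (by simp))

theorem smul_le_smul_iff [T2Space G] (g : G) {α β : StructureLattice G} :
    g • α ≤ g • β ↔ α ≤ β := by
  have key : ∀ (g : G) (α β : StructureLattice G), α ≤ β → g • α ≤ g • β := by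
    intro g α β h
    obtain ⟨H, rfl⟩ := exists_rep α
    obtain ⟨K, rfl⟩ := exists_rep β
    rw [smul_mk, smul_mk]
    rw [mk_le_mk_iff_finCov] at h ⊢
    have := h.image_conj g
    rwa [← coe_conj_smul] at this
  refine ⟨fun h => ?_, key g α β⟩
  simpa using key g⁻¹ _ _ h

/-- A locally normal subgroup fixes every class above its own: for `h ∈ H` and `b ∈ K ∩ N(H)`,
the conjugate `h b h⁻¹ = b (b⁻¹ h b) h⁻¹` lies in the product `K H`. -/
theorem smul_eq_of_mem [T2Space G] {H : LocallyNormal G} {β : StructureLattice G}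
    (hβ : mk H ≤ β) {h : G} (hh : h ∈ H.toSubgroup) : h • β = β := by
  have key : ∀ h ∈ H.toSubgroup, h • β ≤ β := by
    intro h hh
    obtain ⟨K, rfl⟩ := exists_rep β
    rw [mk_le_mk_iff_finCov] at hβ
    rw [smul_mk, mk_le_mk_iff_finCov]
    set N : Subgroup G := normalizer (H.toSubgroup : Set G)
    have h1 : FinCov (K.toSubgroup ⊓ N) (K.toSubgroup : Set G) := by
      rw [finCov_coe_iff, inf_relIndex_left]
      exact relIndex_ne_zero H.isOpen_normalizer K.isCompact
    have h2 := h1.image_conj h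
    rw [← coe_conj_smul] at h2
    refine h2.trans ((FinCov.mul_of_normalizes (A := K.toSubgroup ⊓ N) inf_le_right
      (.of_subset inf_le_left) hβ).mono ?_)
    rw [coe_conj_smul]
    rintro _ ⟨b, hb, rfl⟩
    refine ⟨b, hb, b⁻¹ * h * b * h⁻¹, H.toSubgroup.mul_mem ?_ (H.toSubgroup.inv_mem hh), by group⟩
    have := (inv_mem hb.2 : b⁻¹ ∈ N) h
    simpa using this.mp hh
  refine le_antisymm (key h hh) ?_
  have := (smul_le_smul_iff h).mpr (key h⁻¹ (inv_mem hh))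
  simpa using this

theorem isOpen_stabilizer (α : StructureLattice G) : IsOpen (MulAction.stabilizer G α : Set G) := by
  obtain ⟨H, rfl⟩ := exists_rep α
  refine isOpen_mono (H₁ := normalizer (H.toSubgroup : Set G)) (fun g hg => ?_) H.isOpen_normalizer
  rw [MulAction.mem_stabilizer_iff, smul_mk]
  congr 1
  obtain ⟨K, h1, h2⟩ := H
  simp only [conj, LocallyNormal.mk.injEq]
  ext x
  rw [mem_conj_smul]
  have := (inv_mem hg) x
  simpa using this.symm

theorem smul_eq_of_isLUB [T2Space G] {X : Set (StructureLattice G)} {γ : StructureLattice G}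
    (h : IsLUB X γ) {g : G} (hg : g • X = X) : g • γ = γ := by
  have key : ∀ g : G, g • X = X → g • γ ≤ γ := by
    intro g hg
    rw [← smul_le_smul_iff g⁻¹, inv_smul_smul]
    refine h.2 fun α hα => ?_
    rw [← smul_le_smul_iff g, smul_inv_smul]
    exact h.1 (hg ▸ Set.smul_mem_smul_set hα)
  refine le_antisymm (key g hg) ?_
  rw [← smul_le_smul_iff g⁻¹, inv_smul_smul]
  exact key g⁻¹ (by rw [inv_smul_eq_iff, hg])

variable [LocallyCompactSpace G] [TotallyDisconnectedSpace G]

theorem exists_isLUB_pair (α β : StructureLattice G) : ∃ γ, IsLUB {α, β} γ := by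
  obtain ⟨H, rfl⟩ := exists_rep α
  obtain ⟨K, rfl⟩ := exists_rep β
  obtain ⟨V, hVc, hVo⟩ := exists_compactOpen G
  set U : Subgroup G :=
    normalizer (H.toSubgroup : Set G) ⊓ normalizer (K.toSubgroup : Set G) ⊓ V with hU
  have hUo : IsOpen (U : Set G) := (H.isOpen_normalizer.inter K.isOpen_normalizer).inter hVo
  have norm : ∀ L : Subgroup G, U ≤ normalizer (L : Set G) →
      U ≤ normalizer ((L ⊓ U : Subgroup G) : Set G) := by
    intro L hL g hg n
    have h1 := hL hg n
    have h2 := le_normalizer hg n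
    exact and_congr h1 h2
  have hHn := norm H.toSubgroup (inf_le_left.trans inf_le_left)
  have hKn := norm K.toSubgroup (inf_le_left.trans inf_le_right)
  have hcoe := coe_mul_of_left_le_normalizer_right (H.toSubgroup ⊓ U) (K.toSubgroup ⊓ U)
    (inf_le_right.trans hKn)
  have hUcl : IsClosed (U : Set G) := U.isClosed_of_isOpen hUo
  let J : LocallyNormal G :=
    { toSubgroup := (H.toSubgroup ⊓ U) ⊔ (K.toSubgroup ⊓ U)
      isCompact := by
        rw [hcoe]
        exact (H.isCompact.inter_right hUcl).mul (K.isCompact.inter_right hUcl)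
      isOpen_normalizer := by
        refine isOpen_mono (H₁ := U) (fun g hg => ?_) hUo
        rw [mem_normalizer_iff_map_conj_eq, Subgroup.map_sup,
          (mem_normalizer_iff_map_conj_eq).mp (hHn hg),
          (mem_normalizer_iff_map_conj_eq).mp (hKn hg)] }
  have hle : ∀ L : LocallyNormal G, FinCov (L.toSubgroup ⊓ U) (L.toSubgroup : Set G) := by
    intro L
    rw [finCov_coe_iff, inf_relIndex_left]
    exact relIndex_ne_zero hUo L.isCompact
  refine ⟨mk J, ?_, ?_⟩
  · rintro _ (rfl | rfl)
    · exact mk_le_mk_iff_finCov.mpr ((hle H).trans (.of_subset (le_sup_left : _ ≤ J.toSubgroup)))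
    · exact mk_le_mk_iff_finCov.mpr ((hle K).trans (.of_subset (le_sup_right : _ ≤ J.toSubgroup)))
  · intro γ hγ
    obtain ⟨L, rfl⟩ := exists_rep γ
    have h1 := mk_le_mk_iff_finCov.mp (hγ (Set.mem_insert _ _))
    have h2 := mk_le_mk_iff_finCov.mp (hγ (Set.mem_insert_of_mem _ rfl))
    rw [mk_le_mk_iff_finCov]
    change FinCov _ (((H.toSubgroup ⊓ U) ⊔ (K.toSubgroup ⊓ U) : Subgroup G) : Set G)
    rw [hcoe]
    exact FinCov.mul_of_normalizes (inf_le_right.trans hKn) (h1.mono inf_le_left)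
      (h2.mono inf_le_left)

theorem exists_isLUB_of_finite {X : Set (StructureLattice G)} (hX : X.Finite) :
    ∃ γ, IsLUB X γ := by
  induction X, hX using Set.Finite.induction_on with
  | empty => exact ⟨0, by simp, fun γ _ => StructureLattice.zero_le γ⟩
  | @insert α X _ _ ih =>
    obtain ⟨γ, hγ⟩ := ih
    obtain ⟨δ, hδ⟩ := exists_isLUB_pair α γ
    refine ⟨δ, ?_, fun ε hε => hδ.2 ?_⟩
    · rintro β (rfl | hβ)
      · exact hδ.1 (Set.mem_insert _ _)
      · exact (hγ.1 hβ).trans (hδ.1 (Set.mem_insert_of_mem _ rfl))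
    · rintro β (rfl | rfl)
      · exact hε (Set.mem_insert _ _)
      · exact hγ.2 fun β hβ => hε (Set.mem_insert_of_mem _ hβ)

end StructureLattice

end

/-! ### Finite joins of translates fixed by `G` -/

section

section General

variable {G : Type*} [Group G] [TopologicalSpace G] [IsTopologicalGroup G]

theorem exists_finite_subset_mul {D S : Set G} (hD : Dense D) (hS : IsCompact S) {U : Subgroup G}
    (hU : IsOpen (U : Set G)) : ∃ F ⊆ D, F.Finite ∧ S ⊆ F * (U : Set G) := by
  obtain ⟨F, hFD, hF, hSF⟩ := hS.elim_finite_subcover_image (b := D)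
    (c := fun d => d • (U : Set G)) (fun d _ => hU.smul d) (by
      intro s _
      obtain ⟨d, hdU, hd⟩ := hD.inter_open_nonempty (s • (U : Set G)) (hU.smul s)
        ⟨s, 1, U.one_mem, mul_one s⟩
      obtain ⟨u, hu, rfl⟩ := hdU
      simp only [Set.mem_iUnion]
      exact ⟨_, hd, u⁻¹, U.inv_mem hu, by simp⟩)
  refine ⟨F, hFD, hF, hSF.trans ?_⟩
  simp only [Set.iUnion_subset_iff]
  rintro d hd _ ⟨u, hu, rfl⟩
  exact ⟨d, hd, u, hu, rfl⟩

/-- An element of the normal closure of `H` lies in the subgroup generated by finitely many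
conjugates of `H`. -/
theorem exists_finite_conj_of_mem_normalClosure {G : Type*} [Group G] {H : Subgroup G} {x : G}
    (hx : x ∈ normalClosure (H : Set G)) :
    ∃ I : Set G, I.Finite ∧ ∀ M : Subgroup G, (∀ g ∈ I, ∀ h ∈ H, g * h * g⁻¹ ∈ M) → x ∈ M := by
  induction hx using closure_induction with
  | mem x hx =>
    obtain ⟨h, hh, hc⟩ := Group.mem_conjugatesOfSet_iff.mp hx
    obtain ⟨g, rfl⟩ := isConj_iff.mp hc
    exact ⟨{g}, Set.finite_singleton g, fun M hM => hM g rfl h hh⟩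
  | one => exact ⟨∅, Set.finite_empty, fun M _ => M.one_mem⟩
  | mul x y _ _ ihx ihy =>
    obtain ⟨I, hI, hxI⟩ := ihx
    obtain ⟨J, hJ, hyJ⟩ := ihy
    exact ⟨I ∪ J, hI.union hJ, fun M hM => M.mul_mem (hxI M fun g hg => hM g (.inl hg))
      (hyJ M fun g hg => hM g (.inr hg))⟩
  | inv x _ ih =>
    obtain ⟨I, hI, hxI⟩ := ih
    exact ⟨I, hI, fun M hM => M.inv_mem (hxI M hM)⟩

end General

variable {G : Type*} [Group G] [TopologicalSpace G] [IsClassS G]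

theorem dense_normalClosure {H : Subgroup G} (hH : H ≠ ⊥) :
    Dense (normalClosure (H : Set G) : Set G) := by
  have hn := is_normal_topologicalClosure (normalClosure (H : Set G))
  rcases IsClassS.topologically_simple _ hn (isClosed_topologicalClosure _) with h | h
  · refine absurd ?_ hH
    rw [eq_bot_iff, ← h]
    exact le_normalClosure.trans (le_topologicalClosure _)
  · rw [dense_iff_closure_eq, ← topologicalClosure_coe, h, coe_top]

/-- Writing a compact generating set in terms of an open subgroup `U` and finitely many elements
of the dense normal closure of `H` shows that `G` is generated by `U` and finitely many
conjugates of `H`. -/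
theorem exists_finite_conj_generate {H U : Subgroup G} (hH : H ≠ ⊥) (hU : IsOpen (U : Set G)) :
    ∃ I : Set G, I.Finite ∧ ∀ M : Subgroup G, U ≤ M →
      (∀ g ∈ I, ∀ h ∈ H, g * h * g⁻¹ ∈ M) → M = ⊤ := by
  obtain ⟨S, hSc, hS⟩ := IsClassS.compactly_generated (G := G)
  obtain ⟨F, hFL, hF, hSF⟩ := exists_finite_subset_mul (dense_normalClosure hH) hSc hU
  choose! I hI hIM using fun x (hx : x ∈ F) => exists_finite_conj_of_mem_normalClosure (hFL hx)
  refine ⟨⋃ f ∈ F, I f, hF.biUnion hI, fun M hUM hM => ?_⟩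
  rw [eq_top_iff, ← hS, closure_le]
  intro s hs
  obtain ⟨f, hf, u, hu, rfl⟩ := hSF hs
  exact M.mul_mem (hIM f hf M fun g hg => hM g (Set.mem_biUnion hf hg)) (hUM hu)

theorem exists_isLUB_translates_mem_fixedPoints (α : StructureLattice G) :
    ∃ (n : ℕ) (g : Fin n → G) (β : StructureLattice G),
      1 ≤ n ∧ IsLUB (Set.range fun i => g i • α) β ∧
        β ∈ MulAction.fixedPoints G (StructureLattice G) := by
  -- It suffices to find a finite nonempty set of translates with a fixed join.
  suffices h : ∃ X ⊆ MulAction.orbit G α, X.Finite ∧ X.Nonempty ∧ ∃ β, IsLUB X β ∧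
      β ∈ MulAction.fixedPoints G (StructureLattice G) by
    obtain ⟨X, hXα, hX, hne, β, hβ, hβf⟩ := h
    obtain ⟨n, f, -, rfl⟩ := hX.fin_param
    choose g hg using fun i => hXα ⟨i, rfl⟩
    refine ⟨n, g, β, ?_, ?_, hβf⟩
    · obtain ⟨_, i, rfl⟩ := hne
      exact Nat.one_le_of_lt i.pos
    · convert hβ using 2
      exact funext hg
  obtain ⟨H, rfl⟩ := exists_rep α
  by_cases hH : H.toSubgroup = ⊥
  · refine ⟨{mk H}, Set.singleton_subset_iff.mpr (MulAction.mem_orbit_self _),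
      Set.finite_singleton _, Set.singleton_nonempty _, mk H, isLUB_singleton, fun g => ?_⟩
    rw [smul_mk, mk_eq_mk]
    change Commensurable (ConjAct.toConjAct g • H.toSubgroup) H.toSubgroup
    rw [hH, Subgroup.smul_bot]
  obtain ⟨U, hUc, hUo⟩ := exists_compactOpen G
  obtain ⟨I, hI, hgen⟩ := exists_finite_conj_generate hH hUo
  -- The union of the `U`-orbits of the classes `g • [H]`, `g ∈ I ∪ {1}`.
  let X : Set (StructureLattice G) := ⋃ g ∈ insert 1 I, (fun u => u • g • mk H) '' (U : Set G)
  have hX : X.Finite := by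
    refine (hI.insert 1).biUnion fun g _ => ?_
    obtain ⟨T, hT, hUT⟩ := finCov_coe_iff.mpr (relIndex_ne_zero (isOpen_stabilizer (g • mk H)) hUc)
    refine (hT.image fun t => t • g • mk H).subset ?_
    rintro _ ⟨u, hu, rfl⟩
    obtain ⟨t, ht, s, hs, rfl⟩ := hUT hu
    exact ⟨t, ht, by simp only [mul_smul]; rw [MulAction.mem_stabilizer_iff.mp hs]⟩
  have hIX : ∀ g ∈ insert 1 I, g • mk H ∈ X := fun g hg =>
    Set.mem_biUnion hg ⟨1, U.one_mem, one_smul _ _⟩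
  obtain ⟨β, hβ⟩ := exists_isLUB_of_finite hX
  refine ⟨X, ?_, hX, ⟨_, hIX 1 (Set.mem_insert _ _)⟩, β, hβ, ?_⟩
  · refine Set.iUnion₂_subset fun g _ => ?_
    rintro _ ⟨u, _, rfl⟩
    exact ⟨u * g, mul_smul u g _⟩
  have hsub : ∀ u ∈ U, u • X ⊆ X := by
    rintro u hu _ ⟨_, hx, rfl⟩
    obtain ⟨g, hg, v, hv, rfl⟩ := Set.mem_iUnion₂.mp hx
    exact Set.mem_biUnion hg ⟨u * v, U.mul_mem hu hv, mul_smul u v _⟩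
  have htop : MulAction.stabilizer G β = ⊤ := by
    refine hgen _ (fun u hu => ?_) fun g hg h hh => ?_
    · refine smul_eq_of_isLUB hβ ((hsub u hu).antisymm ?_)
      rw [Set.subset_smul_set_iff]
      exact hsub _ (U.inv_mem hu)
    · refine smul_eq_of_mem (H := conj g H) (hβ.1 (hIX g (Set.mem_insert_of_mem _ hg))) ?_
      exact mem_conj_smul.mpr (by simpa [mul_assoc] using hh)
  exact fun g => MulAction.mem_stabilizer_iff.mp (htop ▸ mem_top g)

end

/-! ### Commensurated compact subgroups -/

section

section General

variable {G : Type*} [Group G] [TopologicalSpace G] [IsTopologicalGroup G]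

theorem exists_open_normalized_subset [TotallyDisconnectedSpace G] {U : Subgroup G}
    (hUc : IsCompact (U : Set G)) (hUo : IsOpen (U : Set G)) {W : Set G} (hW : W ∈ 𝓝 1) :
    ∃ V : Subgroup G, IsOpen (V : Set G) ∧ V ≤ U ∧ (V : Set G) ⊆ W ∧
      U ≤ normalizer (V : Set G) := by
  have := isCompact_iff_compactSpace.mp hUc
  obtain ⟨W', hW'W, hW'o, h1⟩ := mem_nhds_iff.mp hW
  obtain ⟨N, hN⟩ := ProfiniteGrp.exist_openNormalSubgroup_sub_open_nhds_of_one (G := U)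
    (U := (↑) ⁻¹' W') (hW'o.preimage continuous_subtype_val) (by simpa using h1)
  refine ⟨N.toSubgroup.map U.subtype, ?_, map_subtype_le _, ?_, fun g hg => ?_⟩
  · rw [coe_map]
    exact hUo.isOpenMap_subtype_val _ N.toOpenSubgroup.isOpen
  · rintro _ ⟨x, hx, rfl⟩
    exact hW'W (hN hx)
  · have hn := N.isNormal'
    have key : ∀ g ∈ U, ∀ n ∈ N.toSubgroup.map U.subtype,
        g * n * g⁻¹ ∈ N.toSubgroup.map U.subtype := by
      rintro g hg _ ⟨x, hx, rfl⟩
      exact ⟨⟨g, hg⟩ * x * ⟨g, hg⟩⁻¹, hn.conj_mem x hx _, rfl⟩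
    refine fun n => ⟨key g hg n, fun h => ?_⟩
    have := key g⁻¹ (U.inv_mem hg) _ h
    simpa [mul_assoc] using this

/-- An open subgroup `V` contains an open subgroup whose conjugates by the elements of a given
compact set stay in `V`. -/
theorem exists_open_conj_subset {S : Set G} (hS : IsCompact S) {V : Subgroup G}
    (hV : IsOpen (V : Set G)) :
    ∃ V' ≤ V, IsOpen (V' : Set G) ∧ ∀ s ∈ S, ∀ v ∈ V', s * v * s⁻¹ ∈ V := by
  let V' : Subgroup G := V ⊓ ⨅ s ∈ S, V.comap (MulAut.conj s).toMonoidHom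
  have hmem : ∀ v, v ∈ V' ↔ v ∈ V ∧ ∀ s ∈ S, s * v * s⁻¹ ∈ V := by
    intro v
    simp [V', mem_inf]
  refine ⟨V', inf_le_left, ?_, fun s hs v hv => ((hmem v).mp hv).2 s hs⟩
  have h1 : ∀ᶠ v in 𝓝 (1 : G), ∀ s ∈ S, s * v * s⁻¹ ∈ V := by
    refine hS.eventually_forall_of_forall_eventually fun s _ => ?_
    have hc : Continuous fun p : G × G => p.2 * p.1 * p.2⁻¹ := by fun_prop
    exact (hc.continuousAt (x := (1, s))).eventually_mem
      (hV.mem_nhds (by simp))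
  refine isOpen_of_mem_nhds (g := 1) _ ?_
  filter_upwards [h1, hV.mem_nhds V.one_mem] with v hv hvV
  exact (hmem v).mpr ⟨hvV, hv⟩

/-- A closed subgroup which meets `B` in a subgroup of finite index contains a neighbourhood of
`1` in `B`. -/
theorem eventually_mem_of_relIndex_ne_zero {A B : Subgroup G} (hA : IsClosed (A : Set G))
    (h : A.relIndex B ≠ 0) : ∀ᶠ x in 𝓝 (1 : G), x ∈ B → x ∈ A := by
  have hf : (A.subgroupOf B).FiniteIndex := ⟨h⟩
  have ho := isOpen_of_isClosed_of_finiteIndex (A.subgroupOf B) (hA.preimage continuous_subtype_val)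
  obtain ⟨O, hO, hOA⟩ := isOpen_induced_iff.mp ho
  have h1 : (1 : G) ∈ O := by
    have : (1 : B) ∈ (↑) ⁻¹' O := hOA ▸ (A.subgroupOf B).one_mem
    exact this
  filter_upwards [hO.mem_nhds h1] with x hx hxB
  have : (⟨x, hxB⟩ : B) ∈ (↑) ⁻¹' O := hx
  rw [hOA] at this
  exact this

theorem isOpen_of_relIndex_ne_zero {A B : Subgroup G} (hA : IsClosed (A : Set G))
    (hB : IsOpen (B : Set G)) (h : A.relIndex B ≠ 0) : IsOpen (A : Set G) := by
  refine isOpen_of_mem_nhds (g := 1) _ ?_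
  filter_upwards [eventually_mem_of_relIndex_ne_zero hA h, hB.mem_nhds B.one_mem] with x hx hxB
  exact hx hxB

theorem finite_of_relIndex_bot_ne_zero {G : Type*} [Group G] {A : Subgroup G}
    (h : (⊥ : Subgroup G).relIndex A ≠ 0) : (A : Set G).Finite := by
  rw [relIndex_bot_left] at h
  have := Nat.finite_of_card_ne_zero h
  exact Set.toFinite _

namespace StructureLattice

theorem mk_eq_zero_iff {G : Type*} [Group G] [TopologicalSpace G] {H : LocallyNormal G} :
    mk H = 0 ↔ (H.toSubgroup : Set G).Finite := by
  refine mk_eq_mk.trans ⟨fun h => finite_of_relIndex_bot_ne_zero h.2, fun h => ⟨?_, ?_⟩⟩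
  · exact finCov_coe_iff.mp (.of_subset (by simp))
  · exact finCov_coe_iff.mp (.of_finite h)

variable [LocallyCompactSpace G] [TotallyDisconnectedSpace G]

theorem mk_eq_infty_iff {H : LocallyNormal G} :
    mk H = infty G ↔ IsOpen (H.toSubgroup : Set G) := by
  refine ⟨fun h => ?_, fun h => mk_ofCompactOpen _ H.isCompact h⟩
  exact isOpen_of_relIndex_ne_zero H.isCompact.isClosed (exists_compactOpen G).choose_spec.2
    (mk_eq_mk.mp h).1

end StructureLattice

end General

variable {G : Type*} [Group G] [TopologicalSpace G] [IsClassS G]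

variable (G) in
/-- The identity has a countable base of open subgroups. The intersection of a sequence of compact
open subgroups in which each term is conjugated into the previous one by a compact generating set
is a compact normal subgroup, hence trivial. -/
theorem exists_seq_open_subgroups :
    ∃ U : ℕ → Subgroup G, (∀ n, IsOpen (U n : Set G)) ∧
      ∀ W ∈ 𝓝 (1 : G), ∃ n, (U n : Set G) ⊆ W := by
  obtain ⟨S, hSc, hS⟩ := IsClassS.compactly_generated (G := G)
  obtain ⟨x, hx⟩ : ∃ x : G, x ≠ 1 := by
    by_contra! h
    have : Subsingleton G := ⟨fun a b => (h a).trans (h b).symm⟩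
    exact IsClassS.not_discrete (G := G) inferInstance
  obtain ⟨U₀, hU₀c, hU₀o⟩ := exists_compactOpen G
  obtain ⟨V₀, hV₀o, hV₀U, hV₀x, -⟩ := exists_open_normalized_subset hU₀c hU₀o
    (isOpen_compl_singleton.mem_nhds (show (1 : G) ∈ ({x}ᶜ : Set G) from fun h => hx h.symm))
  let step : {V : Subgroup G // IsOpen (V : Set G)} → {V : Subgroup G // IsOpen (V : Set G)} :=
    fun V => ⟨(exists_open_conj_subset (hSc.union hSc.inv) V.2).choose,
      (exists_open_conj_subset (hSc.union hSc.inv) V.2).choose_spec.2.1⟩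
  let U : ℕ → {V : Subgroup G // IsOpen (V : Set G)} := fun n => step^[n] ⟨V₀, hV₀o⟩
  have hsucc : ∀ n, (U (n + 1)).1 ≤ (U n).1 ∧
      ∀ s ∈ S ∪ S⁻¹, ∀ v ∈ (U (n + 1)).1, s * v * s⁻¹ ∈ (U n).1 := by
    intro n
    have := (exists_open_conj_subset (hSc.union hSc.inv) (U n).2).choose_spec
    simp only [U, Function.iterate_succ_apply']
    exact ⟨this.1, this.2.2⟩
  have hanti : Antitone fun n => (U n).1 := antitone_nat_of_succ_le fun n => (hsucc n).1
  let N : Subgroup G := ⨅ n, (U n).1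
  have hconj : ∀ s ∈ S ∪ S⁻¹, ∀ v ∈ N, s * v * s⁻¹ ∈ N := by
    intro s hs v hv
    refine mem_iInf.mpr fun n => (hsucc n).2 s hs v (mem_iInf.mp hv _)
  have hnormal : N.Normal := by
    rw [← normalizer_eq_top_iff, eq_top_iff, ← hS, closure_le]
    refine fun s hs v => ⟨hconj s (.inl hs) v, fun hv => ?_⟩
    have := hconj s⁻¹ (.inr (Set.inv_mem_inv.mpr hs)) _ hv
    simpa [mul_assoc] using this
  have hcl : ∀ n, IsClosed ((U n).1 : Set G) := fun n => isClosed_of_isOpen _ (U n).2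
  have hN : N = ⊥ := by
    refine (IsClassS.topologically_simple N hnormal ?_).resolve_right fun h => ?_
    · rw [coe_iInf]
      exact isClosed_iInter hcl
    · have : x ∈ N := h ▸ mem_top x
      exact hV₀x (mem_iInf.mp this 0) rfl
  refine ⟨fun n => (U n).1, fun n => (U n).2, fun W hW => ?_⟩
  refine exists_subset_nhds_of_isCompact (V := fun n => ((U n).1 : Set G)) ?_ (fun n => ?_) ?_
  · exact directed_of_isDirected_le fun i j hij => hanti hij
  · exact (hU₀c.of_isClosed_subset (isClosed_of_isOpen _ hV₀o) hV₀U).of_isClosed_subset (hcl n)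
      (hanti (Nat.zero_le n))
  · intro y hy
    have : y ∈ N := mem_iInf.mpr (Set.mem_iInter.mp hy)
    rw [hN, Subgroup.mem_bot] at this
    exact this ▸ hW

/-- A compact commensurated subgroup is commensurate to a locally normal one. By Baire category
there are an open set `o V` and a member `B` of a countable base of open subgroups such that
`V` conjugates `K ∩ B` into `o⁻¹ K o`; the closed subgroup generated by these conjugates is
the required one. -/
theorem exists_locallyNormal_commensurable {K : Subgroup G} (hKc : IsCompact (K : Set G))
    (hK : Commensurable.commensurator K = ⊤) :
    ∃ M : LocallyNormal G, Commensurable M.toSubgroup K := by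
  have hcomm : ∀ g : G, Commensurable (ConjAct.toConjAct g • K) K := fun g =>
    (Commensurable.commensurator_mem_iff K g).mp (hK ▸ mem_top g)
  obtain ⟨U, hUo, hU⟩ := exists_seq_open_subgroups G
  let E : ℕ → Set G := fun n => {g | ∀ x ∈ K ⊓ U n, g * x * g⁻¹ ∈ K}
  have hEcl : ∀ n, IsClosed (E n) := by
    intro n
    simp only [E, Set.ofPred_forall]
    refine isClosed_biInter fun x _ => ?_
    exact hKc.isClosed.preimage (by fun_prop : Continuous fun g : G => g * x * g⁻¹)
  have hEU : ⋃ n, E n = Set.univ := by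
    refine Set.eq_univ_of_forall fun g => Set.mem_iUnion.mpr ?_
    have hg : Commensurable (ConjAct.toConjAct g⁻¹ • K) K := hcomm g⁻¹
    have hcl : IsClosed ((ConjAct.toConjAct g⁻¹ • K : Subgroup G) : Set G) := by
      rw [coe_conj_smul]
      exact (hKc.image (by fun_prop)).isClosed
    obtain ⟨n, hn⟩ := hU _ (eventually_mem_of_relIndex_ne_zero hcl hg.1)
    refine ⟨n, fun x hx => ?_⟩
    simpa using mem_conj_smul.mp (hn hx.2 hx.1)
  obtain ⟨n, o, ho⟩ := nonempty_interior_of_iUnion_of_closed hEcl hEU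
  obtain ⟨m, hm⟩ := hU ((o * ·) ⁻¹' interior (E n))
    ((continuous_const_mul o).continuousAt.preimage_mem_nhds
      (isOpen_interior.mem_nhds (by simpa using ho)))
  have hconj : ∀ v ∈ U m, ∀ x ∈ K ⊓ U n, o * (v * x * v⁻¹) * o⁻¹ ∈ K := by
    intro v hv x hx
    have : o * v ∈ E n := interior_subset (hm hv)
    simpa [mul_assoc] using this x hx
  let A : Set G := {x | ∃ v ∈ U m, ∃ k ∈ K ⊓ U n, v * k * v⁻¹ = x}
  let M : Subgroup G := (Subgroup.closure A).topologicalClosure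
  have hAM : A ⊆ M := Subgroup.subset_closure.trans (le_topologicalClosure _)
  have hcpt : IsCompact ((ConjAct.toConjAct o⁻¹ • K : Subgroup G) : Set G) := by
    rw [coe_conj_smul]
    exact hKc.image (by fun_prop)
  have hMK : M ≤ ConjAct.toConjAct o⁻¹ • K := by
    refine topologicalClosure_minimal _ ((closure_le _).mpr ?_) hcpt.isClosed
    rintro _ ⟨v, hv, k, hk, rfl⟩
    exact mem_conj_smul.mpr (by simpa using hconj v hv k hk)
  have hMV : ∀ v ∈ U m, ∀ x ∈ M, v * x * v⁻¹ ∈ M := by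
    intro v hv
    refine topologicalClosure_minimal (t := M.comap (MulAut.conj v).toMonoidHom) _
      ((closure_le _).mpr ?_) ?_
    · rintro _ ⟨w, hw, k, hk, rfl⟩
      refine hAM ⟨v * w, mul_mem hv hw, k, hk, ?_⟩
      simp [mul_assoc]
    · exact (isClosed_topologicalClosure (Subgroup.closure A)).preimage
        (by fun_prop : Continuous fun x : G => v * x * v⁻¹)
  refine ⟨⟨M, hcpt.of_isClosed_subset (isClosed_topologicalClosure _) hMK,
    isOpen_mono (H₁ := U m) (fun v hv x => ⟨hMV v hv x, fun hx => ?_⟩) (hUo m)⟩, ?_, ?_⟩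
  · have := hMV v⁻¹ (inv_mem hv) _ hx
    simpa [mul_assoc] using this
  · have hle : K ⊓ U n ≤ M := fun k hk => hAM ⟨1, one_mem _, k, hk, by simp⟩
    rw [← finCov_coe_iff]
    refine FinCov.trans (B := K ⊓ U n) ?_ (.of_subset hle)
    rw [finCov_coe_iff, inf_relIndex_left]
    exact relIndex_ne_zero (hUo n) hKc
  · rw [← finCov_coe_iff]
    exact (FinCov.of_subset hMK).trans (finCov_coe_iff.mpr (hcomm o⁻¹).2)

theorem finite_or_isOpen_of_commensurated
    (hfix : MulAction.fixedPoints G (StructureLattice G) = {0, infty G}) {K : Subgroup G}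
    (hKc : IsCompact (K : Set G)) (hK : Commensurable.commensurator K = ⊤) :
    (K : Set G).Finite ∨ IsOpen (K : Set G) := by
  obtain ⟨M, hMK⟩ := exists_locallyNormal_commensurable hKc hK
  have hM : mk M ∈ MulAction.fixedPoints G (StructureLattice G) := by
    intro g
    rw [smul_mk, mk_eq_mk]
    exact (hMK.conj (ConjAct.toConjAct g)).trans
      (((Commensurable.commensurator_mem_iff K g).mp (hK ▸ mem_top g)).trans hMK.symm)
  rw [hfix] at hM
  rcases hM with h | h
  · refine .inl (finite_of_relIndex_bot_ne_zero ?_)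
    exact relIndex_ne_zero_trans (mk_eq_mk.mp h).2 hMK.1
  · refine .inr (isOpen_of_relIndex_ne_zero hKc.isClosed (mk_eq_infty_iff.mp h) hMK.symm.1)

end

/-! ### Fixed classes and countable index -/

section

section General

variable {G : Type*} [Group G]

/-- When `H` is commensurated, the sets covered by finitely many left cosets of `H` are closed
under products. -/
theorem FinCov.mul {H : Subgroup G}
    (hH : ∀ g : G, FinCov H ((ConjAct.toConjAct g • H : Subgroup G) : Set G)) {A B : Set G}
    (hA : FinCov H A) (hB : FinCov H B) : FinCov H (A * B) := by
  obtain ⟨T, hT, hTB⟩ := hB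
  have h : ∀ t ∈ T, FinCov H (A * (t • (H : Set G))) := by
    intro t _
    have h1 : FinCov (ConjAct.toConjAct t⁻¹ • H) (A * {t}) := by
      refine ((hA.image_conj t⁻¹).smul t).mono ?_
      rintro _ ⟨a, ha, _, rfl, rfl⟩
      exact ⟨_, ⟨a, ha, rfl⟩, by simp [mul_assoc]⟩
    obtain ⟨C, hC, hAC⟩ := h1.trans (hH t⁻¹)
    refine ⟨C, hC, ?_⟩
    rintro _ ⟨a, ha, _, ⟨x, hx, rfl⟩, rfl⟩
    obtain ⟨c, hc, y, hy, hcy⟩ := hAC ⟨a, ha, t, rfl, rfl⟩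
    refine ⟨c, hc, y * x, H.mul_mem hy hx, ?_⟩
    change c * y = a * t at hcy
    simp only [smul_eq_mul]
    rw [← mul_assoc, hcy, mul_assoc]
  refine (FinCov.biUnion hT h).mono ?_
  rintro _ ⟨a, ha, b, hb, rfl⟩
  obtain ⟨t, ht, x, hx, rfl⟩ := hTB hb
  exact Set.mem_biUnion ht ⟨a, ha, _, ⟨x, hx, rfl⟩, rfl⟩

/-- If `H` is commensurated and has countably many conjugates, then its normal closure is covered
by countably many left cosets of `H`. -/
theorem exists_countable_normalClosure_subset {H : Subgroup G}
    (hH : ∀ g : G, FinCov H ((ConjAct.toConjAct g • H : Subgroup G) : Set G)) {D : Set G}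
    (hD : D.Countable) (hDH : ∀ g : G, ∃ d ∈ D, d⁻¹ * g ∈ normalizer (H : Set G)) :
    ∃ C : Set G, C.Countable ∧ (normalClosure (H : Set G) : Set G) ⊆ C * (H : Set G) := by
  -- Multiply repeatedly on the left by the conjugates of `H`.
  let A : ℕ → Set G := fun n =>
    (fun B => ⋃ d ∈ D, ((ConjAct.toConjAct d • H : Subgroup G) : Set G) * B)^[n] H
  have hsucc : ∀ n, A (n + 1) = ⋃ d ∈ D, ((ConjAct.toConjAct d • H : Subgroup G) : Set G) * A n :=
    fun n => Function.iterate_succ_apply' _ _ _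
  have hA : ∀ n, ∃ C : Set G, C.Countable ∧ A n ⊆ C * (H : Set G) := by
    intro n
    induction n with
    | zero => exact ⟨{1}, Set.countable_singleton 1, by simp [A]⟩
    | succ n ih =>
      obtain ⟨C, hC, hAC⟩ := ih
      have h : ∀ d ∈ D, ∀ c ∈ C, FinCov H
          (((ConjAct.toConjAct d • H : Subgroup G) : Set G) * (c • (H : Set G))) := fun d _ c _ =>
        (hH d).mul hH ((FinCov.of_subset subset_rfl).smul c)
      choose! T hT hTA using h
      refine ⟨⋃ d ∈ D, ⋃ c ∈ C, T d c,
        hD.biUnion fun d hd => hC.biUnion fun c hc => (hT d hd c hc).countable, ?_⟩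
      rw [hsucc]
      refine Set.iUnion₂_subset fun d hd => ?_
      rintro _ ⟨x, hx, a, ha, rfl⟩
      obtain ⟨c, hc, y, hy, rfl⟩ := hAC ha
      obtain ⟨t, ht, z, hz, h⟩ := hTA d hd c hc ⟨x, hx, _, ⟨y, hy, rfl⟩, rfl⟩
      exact ⟨t, Set.mem_biUnion hd (Set.mem_biUnion hc ht), z, hz, h⟩
  choose C hC hAC using hA
  refine ⟨⋃ n, C n, Set.countable_iUnion hC, ?_⟩
  suffices h : ∀ x ∈ normalClosure (H : Set G), ∃ n, x ∈ A n by
    intro x hx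
    obtain ⟨n, hn⟩ := h x hx
    exact Set.mul_subset_mul_right (Set.subset_iUnion C n) (hAC n hn)
  have hstep : ∀ g : G, ∀ h ∈ H, ∀ y n, y ∈ A n → g * h * g⁻¹ * y ∈ A (n + 1) := by
    intro g h hh y n hy
    obtain ⟨d, hd, hdg⟩ := hDH g
    rw [hsucc]
    refine Set.mem_biUnion hd ⟨g * h * g⁻¹, mem_conj_smul.mpr ?_, y, hy, rfl⟩
    have := (hdg h).mp hh
    simpa [mul_assoc] using this
  intro x hx
  induction hx using closure_induction_left with
  | one => exact ⟨0, H.one_mem⟩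
  | mul_left x hx y _ ih =>
    obtain ⟨n, hn⟩ := ih
    obtain ⟨h, hh, hc⟩ := Group.mem_conjugatesOfSet_iff.mp hx
    obtain ⟨g, rfl⟩ := isConj_iff.mp hc
    exact ⟨n + 1, hstep g h hh y n hn⟩
  | inv_mul_cancel x hx y _ ih =>
    obtain ⟨n, hn⟩ := ih
    obtain ⟨h, hh, hc⟩ := Group.mem_conjugatesOfSet_iff.mp hx
    obtain ⟨g, rfl⟩ := isConj_iff.mp hc
    refine ⟨n + 1, ?_⟩
    have := hstep g h⁻¹ (H.inv_mem hh) y n hn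
    simpa [mul_assoc] using this

theorem isOpen_of_countable_cover [TopologicalSpace G] [IsTopologicalGroup G] [BaireSpace G]
    {H : Subgroup G} (hH : IsClosed (H : Set G)) {C : Set G} (hC : C.Countable)
    (h : C * (H : Set G) = Set.univ) : IsOpen (H : Set G) := by
  have := hC.to_subtype
  obtain ⟨c, x, hx⟩ := nonempty_interior_of_iUnion_of_closed
    (f := fun c : C => (c : G) • (H : Set G)) (fun c => hH.smul _) (by
      refine Set.eq_univ_of_forall fun x => Set.mem_iUnion.mpr ?_
      obtain ⟨c, hc, y, hy, rfl⟩ := h.ge (Set.mem_univ x)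
      exact ⟨⟨c, hc⟩, y, hy, rfl⟩)
  refine isOpen_of_mem_nhds (g := (c : G)⁻¹ * x) _ ?_
  have h1 : (c : G) • (H : Set G) ∈ 𝓝 x := mem_interior_iff_mem_nhds.mp hx
  have := (smul_mem_nhds_smul_iff (c : G)⁻¹).mpr h1
  simpa using this

theorem iUnion_pow_eq_univ {S : Set G} (hS : Subgroup.closure S = ⊤) :
    ⋃ n : ℕ, (S ∪ S⁻¹ ∪ {1}) ^ n = Set.univ := by
  refine Set.eq_univ_of_forall fun x => Set.mem_iUnion.mpr ?_
  have hx : x ∈ Subgroup.closure S := hS ▸ mem_top x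
  induction hx using closure_induction with
  | mem x hx => exact ⟨1, by rw [pow_one]; exact .inl (.inl hx)⟩
  | one => exact ⟨0, rfl⟩
  | mul x y _ _ ihx ihy =>
    obtain ⟨m, hm⟩ := ihx
    obtain ⟨n, hn⟩ := ihy
    exact ⟨m + n, by rw [pow_add]; exact ⟨x, hm, y, hn, rfl⟩⟩
  | inv x _ ih =>
    obtain ⟨n, hn⟩ := ih
    refine ⟨n, ?_⟩
    have := Set.inv_mem_inv.mpr hn
    rw [← inv_pow, Set.union_inv, Set.union_inv, inv_inv, Set.union_comm S⁻¹] at this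
    simpa using this

theorem isCompact_union_inv_pow [TopologicalSpace G] [IsTopologicalGroup G] {S : Set G}
    (hS : IsCompact S) (n : ℕ) : IsCompact ((S ∪ S⁻¹ ∪ {1}) ^ n) := by
  induction n with
  | zero => exact isCompact_singleton
  | succ n ih => exact ih.mul ((hS.union hS.inv).union isCompact_singleton)

end General

namespace StructureLattice

variable {G : Type*} [Group G] [TopologicalSpace G] [IsTopologicalGroup G]

theorem finCov_conj_of_mem_fixedPoints {H : LocallyNormal G}
    (hH : mk H ∈ MulAction.fixedPoints G (StructureLattice G)) (g : G) :
    FinCov H.toSubgroup ((ConjAct.toConjAct g • H.toSubgroup : Subgroup G) : Set G) :=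
  finCov_coe_iff.mpr (mk_eq_mk.mp (hH g)).2

/-- A fixed class has a representative which is contained in and normalized by a given compact
open subgroup `U`, namely the intersection of `U` with the finitely many `U`-conjugates of any
representative. -/
theorem exists_rep_normalized [T2Space G] {H : LocallyNormal G}
    (hH : mk H ∈ MulAction.fixedPoints G (StructureLattice G)) {U : Subgroup G}
    (hUc : IsCompact (U : Set G)) (hUo : IsOpen (U : Set G)) :
    ∃ M : LocallyNormal G, mk M = mk H ∧ M.toSubgroup ≤ U ∧
      U ≤ normalizer (M.toSubgroup : Set G) := by
  obtain ⟨T, hT, hUT⟩ := finCov_coe_iff.mpr (relIndex_ne_zero H.isOpen_normalizer hUc)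
  have := hT.to_subtype
  let M : Subgroup G := U ⊓ ⨅ u : U, ConjAct.toConjAct (u : G) • H.toSubgroup
  have hmem : ∀ x, x ∈ M ↔ x ∈ U ∧ ∀ u ∈ U, u⁻¹ * x * u ∈ H.toSubgroup := by
    intro x
    simp only [M, mem_inf, Subgroup.mem_iInf, mem_conj_smul, Subtype.forall]
  have hconj : ∀ u ∈ U, ∀ x ∈ M, u * x * u⁻¹ ∈ M := by
    intro u hu x hx
    rw [hmem] at hx ⊢
    refine ⟨mul_mem (mul_mem hu hx.1) (inv_mem hu), fun v hv => ?_⟩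
    have := hx.2 (u⁻¹ * v) (mul_mem (inv_mem hu) hv)
    simpa [mul_assoc] using this
  have hUM : U ≤ normalizer (M : Set G) := by
    refine fun u hu x => ⟨hconj u hu x, fun hx => ?_⟩
    have := hconj u⁻¹ (inv_mem hu) _ hx
    simpa [mul_assoc] using this
  have hMH : M ≤ H.toSubgroup := fun x hx => by simpa using ((hmem x).mp hx).2 1 (one_mem U)
  have hle : U ⊓ ⨅ t : T, ConjAct.toConjAct (t : G) • H.toSubgroup ≤ M := by
    intro x hx
    refine (hmem x).mpr ⟨hx.1, fun u hu => ?_⟩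
    obtain ⟨t, ht, n, hn, rfl⟩ := hUT hu
    have h1 := mem_conj_smul.mp (mem_iInf.mp hx.2 ⟨t, ht⟩)
    have := ((inv_mem hn : n⁻¹ ∈ normalizer (H.toSubgroup : Set G)) _).mp h1
    simpa [mul_assoc] using this
  have hcl : IsClosed (M : Set G) := by
    simp only [M, coe_inf, coe_iInf]
    refine (isClosed_of_isOpen _ hUo).inter (isClosed_iInter fun u => ?_)
    rw [coe_conj_smul]
    exact (H.isCompact.image (by fun_prop)).isClosed
  refine ⟨⟨M, H.isCompact.of_isClosed_subset hcl hMH, isOpen_mono hUM hUo⟩, ?_, inf_le_left, hUM⟩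
  refine mk_eq_mk.mpr ⟨fun h0 => ?_, finCov_coe_iff.mp (.of_subset hMH)⟩
  have h1 := relIndex_eq_zero_of_le_left hle h0
  revert h1
  refine relIndex_inf_ne_zero (relIndex_ne_zero hUo H.isCompact) (relIndex_iInf_ne_zero fun t => ?_)
  exact (mk_eq_mk.mp (hH t)).1

variable [LocallyCompactSpace G] [TotallyDisconnectedSpace G]

theorem fixedPoints_eq_of_forall_isOpen
    (h : ∀ H : LocallyNormal G, mk H ∈ MulAction.fixedPoints G (StructureLattice G) →
      ¬ (H.toSubgroup : Set G).Finite → IsOpen (H.toSubgroup : Set G)) :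
    MulAction.fixedPoints G (StructureLattice G) = {0, infty G} := by
  refine Set.Subset.antisymm (fun α hα => ?_) ?_
  · obtain ⟨H, rfl⟩ := exists_rep α
    by_cases hf : (H.toSubgroup : Set G).Finite
    · exact .inl (mk_eq_zero_iff.mpr hf)
    · exact .inr (mk_eq_infty_iff.mpr (h H hα hf))
  · rintro _ (rfl | rfl) g
    · refine mk_eq_zero_iff.mpr ?_
      change (((ConjAct.toConjAct g • ⊥ : Subgroup G)) : Set G).Finite
      rw [Subgroup.smul_bot]
      exact Set.finite_singleton _
    · obtain ⟨U, hUc, hUo⟩ := exists_compactOpen G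
      rw [← mk_ofCompactOpen U hUc hUo, smul_mk]
      refine (mk_eq_infty_iff.mpr ?_).trans (mk_ofCompactOpen U hUc hUo).symm
      change IsOpen ((ConjAct.toConjAct g • U : Subgroup G) : Set G)
      have : ((ConjAct.toConjAct g • U : Subgroup G) : Set G) =
          (fun x => g⁻¹ * x * g) ⁻¹' (U : Set G) := by
        ext x
        exact mem_conj_smul
      rw [this]
      exact hUo.preimage (by fun_prop)

end StructureLattice

variable {G : Type*} [Group G] [TopologicalSpace G] [IsClassS G]

/-- The normal closure of a representative of a fixed class is covered by countably many of its
cosets. -/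
theorem exists_countable_cover_of_mem_fixedPoints {H : LocallyNormal G}
    (hH : mk H ∈ MulAction.fixedPoints G (StructureLattice G)) :
    ∃ C : Set G, C.Countable ∧
      (normalClosure (H.toSubgroup : Set G) : Set G) ⊆ C * (H.toSubgroup : Set G) := by
  obtain ⟨S, hSc, hS⟩ := IsClassS.compactly_generated (G := G)
  choose D hD using fun n => exists_finite_subset_mul dense_univ (isCompact_union_inv_pow hSc n)
    H.isOpen_normalizer
  refine exists_countable_normalClosure_subset (finCov_conj_of_mem_fixedPoints hH)
    (D := ⋃ n, D n) (Set.countable_iUnion fun n => (hD n).2.1.countable) fun g => ?_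
  obtain ⟨n, hn⟩ := Set.mem_iUnion.mp ((iUnion_pow_eq_univ hS).ge (Set.mem_univ g))
  obtain ⟨d, hd, x, hx, rfl⟩ := (hD n).2.2 hn
  exact ⟨d, Set.mem_iUnion.mpr ⟨n, hd⟩, by simpa using hx⟩

theorem fixedPoints_eq_of_isSimpleGroup (hG : IsSimpleGroup G) :
    MulAction.fixedPoints G (StructureLattice G) = {0, infty G} := by
  refine fixedPoints_eq_of_forall_isOpen fun H hH hinf => ?_
  have hL : normalClosure (H.toSubgroup : Set G) = ⊤ := by
    refine (hG.eq_bot_or_eq_top_of_normal _ normalClosure_normal).resolve_left fun h => hinf ?_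
    refine (Set.finite_singleton (1 : G)).subset (Set.Subset.trans subset_normalClosure ?_)
    rw [h, coe_bot]
  obtain ⟨C, hC, hLC⟩ := exists_countable_cover_of_mem_fixedPoints hH
  refine isOpen_of_countable_cover H.isCompact.isClosed hC (Set.eq_univ_of_univ_subset ?_)
  rwa [hL, coe_top] at hLC

end

/-! ### Words of bounded length and finite unions of cosets -/

section

section Bounded

variable {G : Type*} [Group G] [TopologicalSpace G] [IsTopologicalGroup G] [T2Space G]

/-- Every element `x` of the normal closure of a commensurated locally normal subgroup `H` is
centralized modulo `H` by a neighbourhood of `1`. The point is that `x⁻¹ v x v⁻¹` tends to `1` as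
`v` does, so that lying in `H` and lying in a given conjugate of `H` are eventually equivalent. -/
theorem eventually_commutator_mem {H : LocallyNormal G}
    (hH : ∀ g : G, FinCov H.toSubgroup ((ConjAct.toConjAct g • H.toSubgroup : Subgroup G) : Set G))
    {x : G} (hx : x ∈ normalClosure (H.toSubgroup : Set G)) :
    ∀ᶠ v in 𝓝 (1 : G), x⁻¹ * (v * x * v⁻¹) ∈ H.toSubgroup := by
  have htend : ∀ y : G, Tendsto (fun v : G => y⁻¹ * (v * y * v⁻¹)) (𝓝 1) (𝓝 1) := by
    intro y
    have : Continuous fun v : G => y⁻¹ * (v * y * v⁻¹) := by fun_prop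
    simpa using this.tendsto 1
  have hconj : ∀ y : G, ∀ᶠ z in 𝓝 (1 : G), y * z * y⁻¹ ∈ H.toSubgroup → z ∈ H.toSubgroup := by
    intro y
    have := eventually_mem_of_relIndex_ne_zero H.isCompact.isClosed (finCov_coe_iff.mp (hH y⁻¹))
    filter_upwards [this] with z hz hyz
    exact hz (mem_conj_smul.mpr (by simpa using hyz))
  have hconj' : ∀ y : G, ∀ᶠ z in 𝓝 (1 : G), z ∈ H.toSubgroup → y * z * y⁻¹ ∈ H.toSubgroup := by
    intro y
    have hc : Tendsto (fun z : G => y * z * y⁻¹) (𝓝 1) (𝓝 1) := by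
      have : Continuous fun z : G => y * z * y⁻¹ := by fun_prop
      simpa using this.tendsto 1
    filter_upwards [hc.eventually (hconj y⁻¹)] with z hz hzH
    exact hz (by simpa [mul_assoc] using hzH)
  induction hx using closure_induction with
  | mem x hx =>
    obtain ⟨h, hh, hc⟩ := Group.mem_conjugatesOfSet_iff.mp hx
    obtain ⟨g, rfl⟩ := isConj_iff.mp hc
    have hN := (conj g H).isOpen_normalizer.mem_nhds (one_mem _)
    filter_upwards [hN, (htend (g * h * g⁻¹)).eventually (hconj g⁻¹)] with v hv hz
    have h1 : g * h * g⁻¹ ∈ (conj g H).toSubgroup :=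
      mem_conj_smul.mpr (by simpa [mul_assoc] using hh)
    have h2 := mul_mem (inv_mem h1) ((hv _).mp h1)
    refine hz ?_
    simpa using mem_conj_smul.mp h2
  | one => simp
  | mul x y _ _ ihx ihy =>
    filter_upwards [ihx, ihy, (htend x).eventually (hconj' y⁻¹)] with v hvx hvy hz
    have := mul_mem (hz hvx) hvy
    simpa [mul_assoc] using this
  | inv x _ ih =>
    filter_upwards [ih, (htend x).eventually (hconj' x)] with v hv hz
    have := inv_mem (hz hv)
    simpa [mul_assoc] using this

/-- The union of the `U`-conjugates of a subset of the normal closure of `H` which is covered by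
finitely many cosets of `H` is again such a subset. -/
theorem FinCov.conj_closure [TotallyDisconnectedSpace G] {H : LocallyNormal G}
    (hH : ∀ g : G, FinCov H.toSubgroup ((ConjAct.toConjAct g • H.toSubgroup : Subgroup G) : Set G))
    {U : Subgroup G} (hUc : IsCompact (U : Set G)) (hUo : IsOpen (U : Set G))
    (hUH : U ≤ normalizer (H.toSubgroup : Set G)) {A : Set G}
    (hA : FinCov H.toSubgroup A) (hAL : A ⊆ normalClosure (H.toSubgroup : Set G)) :
    FinCov H.toSubgroup {x | ∃ u ∈ U, ∃ a ∈ A, u * a * u⁻¹ = x} := by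
  obtain ⟨T, hTA, hT, hAT⟩ := hA.exists_subset
  have h : ∀ t ∈ T, FinCov H.toSubgroup
      {x | ∃ u ∈ U, ∃ h ∈ H.toSubgroup, u * (t * h) * u⁻¹ = x} := by
    intro t ht
    obtain ⟨V, hVo, hVU, hV, -⟩ := exists_open_normalized_subset hUc hUo
      (eventually_commutator_mem hH (hAL (hTA ht)))
    obtain ⟨F, hFU, hF, hUF⟩ := (finCov_coe_iff.mpr (relIndex_ne_zero hVo hUc)).exists_subset
    refine ⟨(fun f => f * t * f⁻¹) '' F, hF.image _, ?_⟩
    rintro _ ⟨u, hu, h, hh, rfl⟩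
    obtain ⟨f, hf, v, hv, rfl⟩ := hUF hu
    refine ⟨_, ⟨f, hf, rfl⟩, _, mul_mem ((hUH (hFU hf) _).mp (hV hv)) ((hUH hu h).mp hh), ?_⟩
    simp [mul_assoc]
  refine (FinCov.biUnion hT h).mono ?_
  rintro _ ⟨u, hu, a, ha, rfl⟩
  obtain ⟨t, ht, h, hh, rfl⟩ := hAT ha
  exact Set.mem_biUnion ht ⟨u, hu, h, hh, rfl⟩

/-- The elements of `U` in a subset of the normal closure of `H` which is covered by finitely many
cosets of `H` are simultaneously centralized modulo `H` by an open normal subgroup of `U`. -/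
theorem FinCov.exists_open_commutator_mem [TotallyDisconnectedSpace G] {H : LocallyNormal G}
    (hH : ∀ g : G, FinCov H.toSubgroup ((ConjAct.toConjAct g • H.toSubgroup : Subgroup G) : Set G))
    {U : Subgroup G} (hUc : IsCompact (U : Set G)) (hUo : IsOpen (U : Set G))
    (hUH : U ≤ normalizer (H.toSubgroup : Set G)) {A : Set G}
    (hA : FinCov H.toSubgroup A) (hAL : A ⊆ normalClosure (H.toSubgroup : Set G)) :
    ∃ V : Subgroup G, IsOpen (V : Set G) ∧ V ≤ U ∧ U ≤ normalizer (V : Set G) ∧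
      ∀ x ∈ A, ∀ v ∈ V, x⁻¹ * (v * x * v⁻¹) ∈ H.toSubgroup := by
  obtain ⟨T, hTA, hT, hAT⟩ := hA.exists_subset
  obtain ⟨V, hVo, hVU, hV, hVn⟩ := exists_open_normalized_subset hUc hUo
    ((eventually_all_finite hT).mpr fun t ht => eventually_commutator_mem hH (hAL (hTA ht)))
  refine ⟨V, hVo, hVU, hVn, fun x hx v hv => ?_⟩
  obtain ⟨t, ht, h, hh, rfl⟩ := hAT hx
  have := mul_mem (mul_mem (inv_mem hh) (hV hv t ht)) ((hUH (hVU hv) h).mp hh)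
  simpa [mul_assoc] using this

/-- Suppose that the letters `s` take values `e s = f s * u s` in `G`, where `u s ∈ U` and `f s` lies
in a finite subset of the normal closure of `H`. Then, for words `w` of bounded length, the elements
`w(e) * w(u)⁻¹` lie in the normal closure of `H` and in finitely many cosets of `H`. -/
theorem finCov_word_values [TotallyDisconnectedSpace G] {H : LocallyNormal G}
    (hH : ∀ g : G, FinCov H.toSubgroup ((ConjAct.toConjAct g • H.toSubgroup : Subgroup G) : Set G))
    {U : Subgroup G} (hUc : IsCompact (U : Set G)) (hUo : IsOpen (U : Set G))
    (hUH : U ≤ normalizer (H.toSubgroup : Set G)) {S : Type*} (e : S → G) (u : S → U) {F : Set G}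
    (hF : F.Finite) (hFL : F ⊆ normalClosure (H.toSubgroup : Set G))
    (heu : ∀ s, e s * (u s : G)⁻¹ ∈ F) (k : ℕ) :
    ∃ A : Set G, FinCov H.toSubgroup A ∧ A ⊆ normalClosure (H.toSubgroup : Set G) ∧
      ∀ w : List (S × Bool), w.length ≤ k →
        FreeGroup.lift e (.mk w) * (FreeGroup.lift u (.mk w) : G)⁻¹ ∈ A := by
  set L : Subgroup G := normalClosure (H.toSubgroup : Set G)
  have hL : L.Normal := normalClosure_normal
  induction k with
  | zero =>
    refine ⟨{1}, .of_finite (Set.finite_singleton 1), by simp [one_mem], fun w hw => ?_⟩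
    rw [List.eq_nil_of_length_eq_zero (Nat.le_zero.mp hw), ← FreeGroup.one_eq_mk]
    simp
  | succ k ih =>
    obtain ⟨A, hA, hAL, hAw⟩ := ih
    have hFi : F⁻¹ ⊆ L := fun x hx => inv_mem_iff.mp (hFL hx)
    have hcl : ∀ B : Set G, B ⊆ L → {x | ∃ u ∈ U, ∃ a ∈ B, u * a * u⁻¹ = x} ⊆ L := by
      rintro B hB _ ⟨u, _, a, ha, rfl⟩
      exact hL.conj_mem a (hB ha) u
    have h1 := FinCov.conj_closure hH hUc hUo hUH (.of_finite hF.inv) hFi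
    have h2 := FinCov.conj_closure hH hUc hUo hUH hA hAL
    refine ⟨{1} ∪ (F ∪ {x | ∃ u ∈ U, ∃ a ∈ F⁻¹, u * a * u⁻¹ = x}) *
      {x | ∃ u ∈ U, ∃ a ∈ A, u * a * u⁻¹ = x}, ?_, ?_, ?_⟩
    · exact FinCov.union (.of_finite (Set.finite_singleton 1))
        (((FinCov.of_finite hF).union h1).mul hH h2)
    · refine Set.union_subset (by simp [one_mem]) ?_
      rintro _ ⟨x, hx, y, hy, rfl⟩
      exact L.mul_mem (Set.union_subset hFL (hcl _ hFi) hx) (hcl _ hAL hy)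
    · rintro (_ | ⟨⟨s, b⟩, w⟩) hw
      · left
        rw [← FreeGroup.one_eq_mk]
        simp
      · right
        have hmk : (FreeGroup.mk ((s, b) :: w) : FreeGroup S) =
            FreeGroup.mk [(s, b)] * FreeGroup.mk w := by
          rw [FreeGroup.mul_mk]
          rfl
        have hw' := hAw w (by simpa using hw)
        cases b with
        | true =>
          refine ⟨_, .inl (heu s), _, ⟨u s, (u s).2, _, hw', rfl⟩, ?_⟩
          have h1 : FreeGroup.lift e (.mk [(s, true)]) = e s := by simp
          have h2 : FreeGroup.lift u (.mk [(s, true)]) = u s := by simp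
          rw [hmk, map_mul, map_mul, h1, h2, Subgroup.coe_mul]
          group
        | false =>
          refine ⟨_, .inr ⟨(u s : G)⁻¹, inv_mem (u s).2, _, Set.inv_mem_inv.mpr (heu s), rfl⟩,
            _, ⟨(u s : G)⁻¹, inv_mem (u s).2, _, hw', rfl⟩, ?_⟩
          have h1 : FreeGroup.lift e (.mk [(s, false)]) = (e s)⁻¹ := by simp
          have h2 : FreeGroup.lift u (.mk [(s, false)]) = (u s)⁻¹ := by simp
          rw [hmk, map_mul, map_mul, h1, h2, Subgroup.coe_mul, Subgroup.coe_inv]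
          group

/-- A compact subset of a group generated by a compact set `S` consists of values of words in `S`
of bounded length. -/
theorem exists_forall_word_length_le [BaireSpace G] {S : Set G} (hSc : IsCompact S)
    (hS : Subgroup.closure S = ⊤) {K : Set G} (hK : IsCompact K) :
    ∃ m : ℕ, ∀ x ∈ K, ∃ w : List (S × Bool), w.length ≤ m ∧
      FreeGroup.lift (fun s : S => (s : G)) (.mk w) = x := by
  set A : Set G := S ∪ S⁻¹ ∪ {1}
  have hA : (1 : G) ∈ A := .inr rfl
  obtain ⟨m, y, hy⟩ := nonempty_interior_of_iUnion_of_closed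
    (fun n => (isCompact_union_inv_pow hSc n).isClosed) (iUnion_pow_eq_univ hS)
  have hy' : A ^ m ∈ 𝓝 y := mem_interior_iff_mem_nhds.mp hy
  choose n hn using fun x : G => Set.mem_iUnion.mp ((iUnion_pow_eq_univ hS).ge (Set.mem_univ x))
  obtain ⟨t, -, ht⟩ := hK.elim_nhds_subcover (fun x => (x * y⁻¹) • A ^ m) fun x _ => by
    have := (smul_mem_nhds_smul_iff (x * y⁻¹)).mpr hy'
    simpa using this
  have hword : ∀ k : ℕ, ∀ x ∈ A ^ k, ∃ w : List (S × Bool), w.length ≤ k ∧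
      FreeGroup.lift (fun s : S => (s : G)) (.mk w) = x := by
    intro k
    induction k with
    | zero =>
      rintro x rfl
      exact ⟨[], le_rfl, by simp⟩
    | succ k ih =>
      intro x hx
      rw [pow_succ'] at hx
      obtain ⟨a, ha, z, hz, rfl⟩ := hx
      obtain ⟨w, hw, rfl⟩ := ih z hz
      rcases ha with (ha | ha) | rfl
      · exact ⟨(⟨a, ha⟩, true) :: w, by simpa using hw, by simp [FreeGroup.lift_mk]⟩
      · exact ⟨(⟨a⁻¹, ha⟩, false) :: w, by simpa using hw, by simp [FreeGroup.lift_mk]⟩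
      · exact ⟨w, by lia, by simp⟩
  refine ⟨t.sup (fun x => n (x * y⁻¹)) + m, fun x hx => hword _ x ?_⟩
  obtain ⟨k, hk, a, ha, rfl⟩ := Set.mem_iUnion₂.mp (ht hx)
  rw [pow_add]
  exact ⟨_, Set.pow_subset_pow_right hA (Finset.le_sup (f := fun x => n (x * y⁻¹)) hk) (hn _),
    a, ha, rfl⟩

end Bounded

end

/-! ### Compactly presented groups -/

section

/-- Schur's theorem: a group whose centre has finite index has a finite commutator subgroup,
because `⁅x, y⁆` only depends on the classes of `x` and `y` modulo the centre. -/
theorem finite_commutator_of_finiteIndex_center {Q : Type*} [Group Q] [(center Q).FiniteIndex] :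
    Finite (commutator Q) := by
  have : Finite (commutatorSet Q) := by
    refine ((Set.finite_range fun p : (Q ⧸ center Q) × (Q ⧸ center Q) =>
      ⁅p.1.out, p.2.out⁆).subset ?_).to_subtype
    rintro _ ⟨x, y, rfl⟩
    refine ⟨(x, y), ?_⟩
    obtain ⟨z, hz⟩ := QuotientGroup.mk_out_eq_mul (center Q) x
    obtain ⟨w, hw⟩ := QuotientGroup.mk_out_eq_mul (center Q) y
    have hzc := fun g => mem_center_iff.mp z.2 g
    have hwc := fun g => mem_center_iff.mp w.2 g
    generalize (z : Q) = z at hz hzc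
    generalize (w : Q) = w at hw hwc
    have h1 : ⁅x * z, y * w⁆ = ⁅x, y * w⁆ := by
      simp only [commutatorElement_def, mul_inv_rev]
      calc x * z * (y * w) * (z⁻¹ * x⁻¹) * (w⁻¹ * y⁻¹)
          = x * (z * (y * w)) * (z⁻¹ * x⁻¹) * (w⁻¹ * y⁻¹) := by group
        _ = x * ((y * w) * z) * (z⁻¹ * x⁻¹) * (w⁻¹ * y⁻¹) := by rw [hzc]
        _ = x * (y * w) * x⁻¹ * (w⁻¹ * y⁻¹) := by group
    have h2 : ⁅x, y * w⁆ = ⁅x, y⁆ := by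
      simp only [commutatorElement_def, mul_inv_rev]
      calc x * (y * w) * x⁻¹ * (w⁻¹ * y⁻¹) = x * y * (w * x⁻¹) * (w⁻¹ * y⁻¹) := by group
        _ = x * y * (x⁻¹ * w) * (w⁻¹ * y⁻¹) := by rw [hwc]
        _ = x * y * x⁻¹ * y⁻¹ := by group
    simp only [hz, hw, h1, h2]
  infer_instance

variable {G : Type*} [Group G] [TopologicalSpace G] [IsClassS G]

/-- Let `G` be compactly presented and let `H` represent a nonzero fixed class and be normal in
the compact open subgroup `U`. Then `U / H` has a centre of finite index.

Let `L` be the dense normal closure of `H`, so that `G = L U`. Each generator `s` is congruent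
modulo `L` to some `u s ∈ U`, with `s (u s)⁻¹` in a finite set. The values in `U` of the bounded
relators then lie in finitely many cosets of `H` in `L`, hence in the subgroup `C` of `U`
centralizing modulo `H` some open normal subgroup `V` of `U`. Thus `s ↦ u s` induces a homomorphism
from `G` to `U / C`. For small enough `V` it restricts to the quotient map on `U`; so it kills `H`,
hence also `L`, and therefore `L ∩ U ≤ C`. As `L ∩ U` is dense in `U`, this means that `V` is
central in `U` modulo `H`. -/
theorem finiteIndex_center_of_isCompactlyPresented (hG : IsCompactlyPresented G)
    {H : LocallyNormal G} (hfix : mk H ∈ MulAction.fixedPoints G (StructureLattice G))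
    (hbot : H.toSubgroup ≠ ⊥) {U : Subgroup G} (hUc : IsCompact (U : Set G))
    (hUo : IsOpen (U : Set G)) (hHU : H.toSubgroup ≤ U)
    (hUH : U ≤ normalizer (H.toSubgroup : Set G)) [hn : (H.toSubgroup.subgroupOf U).Normal] :
    (center (U ⧸ H.toSubgroup.subgroupOf U)).FiniteIndex := by
  obtain ⟨S, R, n, hSc, hR, hsurj, hker⟩ := hG
  have hH := finCov_conj_of_mem_fixedPoints hfix
  set L : Subgroup G := normalClosure (H.toSubgroup : Set G)
  have hdense : Dense (L : Set G) := dense_normalClosure hbot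
  have hS : Subgroup.closure S = ⊤ := by
    rw [← MonoidHom.range_eq_top, FreeGroup.range_lift_eq_closure, Subtype.range_coe] at hsurj
    exact hsurj
  obtain ⟨m, hm⟩ := exists_forall_word_length_le hSc hS hUc
  obtain ⟨F, hFL, hF, hSF⟩ := exists_finite_subset_mul hdense hSc hUo
  have hu : ∀ s : S, ∃ u : U, (s : G) * (u : G)⁻¹ ∈ F := by
    rintro ⟨s, hs⟩
    obtain ⟨f, hf, u, hu, rfl⟩ := hSF hs
    exact ⟨⟨u, hu⟩, by simpa using hf⟩
  choose u hu using hu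
  obtain ⟨A, hA, hAL, hAw⟩ := finCov_word_values hH hUc hUo hUH (fun s : S => (s : G)) u hF hFL hu
    (max n m)
  obtain ⟨V, hVo, hVU, hVn, hV⟩ := FinCov.exists_open_commutator_mem hH hUc hUo hUH hA hAL
  set ev : FreeGroup S →* G := FreeGroup.lift fun s : S => (s : G) with hev
  set ψ : FreeGroup S →* U := FreeGroup.lift u
  let q : U →* U ⧸ H.toSubgroup.subgroupOf U := QuotientGroup.mk' _
  have hVnormal : (V.subgroupOf U).Normal :=
    (normal_subgroupOf_iff_le_normalizer hVU).mpr hVn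
  have hmapn : ((V.subgroupOf U).map q).Normal := hVnormal.map q (QuotientGroup.mk'_surjective _)
  let C : Subgroup U := (centralizer ((V.subgroupOf U).map q : Set _)).comap q
  have hCn : C.Normal := Subgroup.Normal.comap inferInstance q
  have hC : ∀ x : U, x ∈ C ↔ ∀ v ∈ V, (x : G)⁻¹ * (v * x * v⁻¹) ∈ H.toSubgroup := by
    intro x
    have hq : ∀ v : U, q v * q x = q x * q v ↔
        (x : G)⁻¹ * (v * x * (v : G)⁻¹) ∈ H.toSubgroup := by
      intro v
      have h1 : q v * q x = q x * q v ↔ q x = q (v * x * v⁻¹) := by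
        rw [map_mul, map_mul, map_inv, eq_mul_inv_iff_mul_eq, eq_comm]
      rw [h1]
      exact QuotientGroup.eq.trans mem_subgroupOf
    rw [Subgroup.mem_comap, mem_centralizer_iff]
    constructor
    · intro h v hv
      exact (hq ⟨v, hVU hv⟩).mp (h _ ⟨_, mem_subgroupOf.mpr hv, rfl⟩)
    · rintro h _ ⟨v, hv, rfl⟩
      exact (hq v).mpr (h v (mem_subgroupOf.mp hv))
  have hAC : ∀ x : U, (x : G) ∈ A → x ∈ C := fun x hx => (hC x).mpr (hV x hx)
  let φ : FreeGroup S →* U ⧸ C := (QuotientGroup.mk' C).comp ψ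
  have hφ : ∀ w, φ w = 1 ↔ ψ w ∈ C := fun w => QuotientGroup.eq_one_iff _
  -- The relators, hence all relations, are killed by `φ`.
  have hkerφ : ev.ker ≤ φ.ker := by
    rw [hker]
    refine normalClosure_le_normal fun r hr => ?_
    obtain ⟨w, hw, hwr⟩ := hR r hr
    have h1 : ev r = 1 := by
      rw [← MonoidHom.mem_ker, hker]
      exact subset_normalClosure hr
    have h2 := hAw w (hw.trans (le_max_left _ _))
    rw [hwr, h1, one_mul] at h2
    refine (hφ r).mpr (inv_mem_iff.mp (hAC _ ?_))
    exact h2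
  -- `φ` induces the quotient map on `U`.
  have hφU : ∀ x : U, ∀ w, ev w = x → (ψ w ∈ C ↔ x ∈ C) := by
    intro x w hw
    obtain ⟨w', hw', hx⟩ := hm x x.2
    have h1 : x * (ψ (.mk w'))⁻¹ ∈ C := hAC _ (by
      have := hAw w' (hw'.trans (le_max_right _ _))
      rwa [hx] at this)
    have h2 : w * (FreeGroup.mk w')⁻¹ ∈ φ.ker := hkerφ (by
      rw [MonoidHom.mem_ker, map_mul, map_inv, hw, hev, hx, mul_inv_cancel])
    rw [MonoidHom.mem_ker, map_mul, map_inv, mul_inv_eq_one] at h2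
    rw [← hφ, h2, hφ, ← C.mul_mem_cancel_left h1, inv_mul_cancel_right]
  have hLφ : L ≤ φ.ker.map ev := by
    have : (φ.ker.map ev).Normal := Subgroup.Normal.map inferInstance ev hsurj
    refine normalClosure_le_normal fun h hh => ?_
    obtain ⟨w, rfl⟩ := hsurj h
    refine ⟨w, (hφ w).mpr ((hφU ⟨_, hHU hh⟩ w rfl).mpr ((hC _).mpr fun v hv => ?_)), rfl⟩
    exact mul_mem (inv_mem hh) ((hUH (hVU hv) _).mp hh)
  have hLC : ∀ x : U, (x : G) ∈ L → x ∈ C := by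
    intro x hx
    obtain ⟨w, hw, hwx⟩ := hLφ hx
    exact (hφU x w hwx).mp ((hφ w).mp hw)
  have hCtop : ∀ x : U, x ∈ C := by
    let D : Set G := {x | ∀ v ∈ V, x⁻¹ * (v * x * v⁻¹) ∈ H.toSubgroup}
    have hD : IsClosed D := by
      simp only [D, Set.ofPred_forall]
      exact isClosed_biInter fun v _ => H.isCompact.isClosed.preimage
        (by fun_prop : Continuous fun x : G => x⁻¹ * (v * x * v⁻¹))
    have hsub : (U : Set G) ∩ L ⊆ D := fun x hx => (hC ⟨x, hx.1⟩).mp (hLC ⟨x, hx.1⟩ hx.2)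
    intro x
    exact (hC x).mpr (closure_minimal hsub hD (hdense.open_subset_closure_inter hUo x.2))
  have hfin : ((V.subgroupOf U).map q).FiniteIndex := by
    have : (V.subgroupOf U).FiniteIndex := ⟨relIndex_ne_zero hVo hUc⟩
    exact ⟨fun h => this.index_ne_zero (Nat.eq_zero_of_zero_dvd
      (h ▸ index_map_dvd _ (QuotientGroup.mk'_surjective _)))⟩
  refine finiteIndex_of_le (H := (V.subgroupOf U).map q) fun z hz => ?_
  refine mem_center_iff.mpr fun y => ?_
  obtain ⟨x, rfl⟩ := QuotientGroup.mk'_surjective _ y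
  exact (mem_centralizer_iff.mp (hCtop x) z hz).symm

/-- If `Q = U / H` has finite commutator subgroup and `U / closure [U, U]` is finite, then `Q`
is finite. -/
theorem relIndex_ne_zero_of_finite_quotient {U : Subgroup G} {H : LocallyNormal G}
    [hn : (H.toSubgroup.subgroupOf U).Normal]
    [Finite (commutator (U ⧸ H.toSubgroup.subgroupOf U))]
    [hfin : Finite (U ⧸ (commutator U).topologicalClosure)] :
    H.toSubgroup.relIndex U ≠ 0 := by
  let q : U →* U ⧸ H.toSubgroup.subgroupOf U := QuotientGroup.mk' _
  have hcl : IsClosed (H.toSubgroup.subgroupOf U : Set U) :=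
    H.isCompact.isClosed.preimage continuous_subtype_val
  have hclosed : IsClosed ((commutator (U ⧸ H.toSubgroup.subgroupOf U)).comap q : Set U) :=
    (Set.toFinite ((commutator (U ⧸ H.toSubgroup.subgroupOf U) : Subgroup _) :
      Set (U ⧸ H.toSubgroup.subgroupOf U))).isClosed.preimage
        (QuotientGroup.continuous_mk (N := H.toSubgroup.subgroupOf U))
  have hle : (commutator U).topologicalClosure ≤
      (commutator (U ⧸ H.toSubgroup.subgroupOf U)).comap q := by
    refine topologicalClosure_minimal _ (map_le_iff_le_comap.mp ?_) hclosed
    rw [commutator_def, map_commutator]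
    exact commutator_mono le_top le_top
  have h1 : ((commutator U).topologicalClosure).FiniteIndex := finiteIndex_of_finite_quotient
  have h2 := (finiteIndex_of_le hle).index_ne_zero
  rw [index_comap_of_surjective _ (QuotientGroup.mk'_surjective _)] at h2
  have h3 : (⊥ : Subgroup (U ⧸ H.toSubgroup.subgroupOf U)).index ≠ 0 := by
    rw [← relIndex_mul_index (bot_le : ⊥ ≤ commutator (U ⧸ H.toSubgroup.subgroupOf U)),
      relIndex_bot_left]
    exact mul_ne_zero Nat.card_pos.ne' h2
  rw [index_bot] at h3
  exact h3

/-- When `G` is perfect and `U / H` has finite commutator subgroup, the quotient of `G` by the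
normal closure `L` of `H` is a perfect quotient of `U / H`, hence finite. So `H` has countable
index in `G`, and is open by Baire category. -/
theorem isOpen_of_isPerfect [hG : Group.IsPerfect G] {H : LocallyNormal G}
    (hfix : mk H ∈ MulAction.fixedPoints G (StructureLattice G))
    (hbot : H.toSubgroup ≠ ⊥) {U : Subgroup G} (hUo : IsOpen (U : Set G))
    [hn : (H.toSubgroup.subgroupOf U).Normal]
    [Finite (commutator (U ⧸ H.toSubgroup.subgroupOf U))] :
    IsOpen (H.toSubgroup : Set G) := by
  set L : Subgroup G := normalClosure (H.toSubgroup : Set G)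
  have hLn : L.Normal := normalClosure_normal
  have hdense : Dense (L : Set G) := dense_normalClosure hbot
  let p : (U ⧸ H.toSubgroup.subgroupOf U) →* G ⧸ L :=
    QuotientGroup.map _ L U.subtype fun x hx => le_normalClosure (mem_subgroupOf.mp hx)
  have hp : Function.Surjective p := by
    intro y
    obtain ⟨g, rfl⟩ := QuotientGroup.mk_surjective y
    obtain ⟨_, ⟨x, hx, rfl⟩, hxL⟩ := hdense.inter_open_nonempty (g⁻¹ • (U : Set G)) (hUo.smul _)
      ⟨g⁻¹, 1, U.one_mem, mul_one _⟩
    refine ⟨((⟨x, hx⟩ : U) : U ⧸ H.toSubgroup.subgroupOf U), ?_⟩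
    change (QuotientGroup.mk x : G ⧸ L) = _
    exact (QuotientGroup.eq.mpr hxL).symm
  have htop : (commutator (U ⧸ H.toSubgroup.subgroupOf U)).map p = ⊤ := by
    have h1 : (commutator G).map (QuotientGroup.mk' L) = ⊤ := by
      rw [hG.commutator_eq_top, ← MonoidHom.range_eq_map]
      exact MonoidHom.range_eq_top.mpr (QuotientGroup.mk'_surjective L)
    rw [commutator_def, map_commutator, ← MonoidHom.range_eq_map,
      MonoidHom.range_eq_top.mpr (QuotientGroup.mk'_surjective L)] at h1
    rw [commutator_def, map_commutator, ← MonoidHom.range_eq_map, MonoidHom.range_eq_top.mpr hp, h1]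
  have hfin : Finite (G ⧸ L) := by
    have : (Set.univ : Set (G ⧸ L)).Finite := by
      rw [← coe_top, ← htop, coe_map]
      exact (Set.toFinite (commutator (U ⧸ H.toSubgroup.subgroupOf U) : Set _)).image p
    exact Set.finite_univ_iff.mp this
  obtain ⟨C, hC, hLC⟩ := exists_countable_cover_of_mem_fixedPoints hfix
  refine isOpen_of_countable_cover H.isCompact.isClosed
    (C := (Set.range fun y : G ⧸ L => y.out) * C) ((Set.countable_range _).image2 hC _) ?_
  refine Set.eq_univ_of_forall fun g => ?_
  rw [mul_assoc]
  refine ⟨_, ⟨(g : G ⧸ L), rfl⟩, _, hLC ?_, mul_inv_cancel_left _ g⟩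
  exact QuotientGroup.eq.mp (QuotientGroup.out_eq' (g : G ⧸ L))

theorem fixedPoints_eq_of_isCompactlyPresented (hG : IsCompactlyPresented G)
    (h : Group.IsPerfect G ∨
      ∃ U : Subgroup G, IsCompact (U : Set G) ∧ IsOpen (U : Set G) ∧
        Finite (U ⧸ (commutator U).topologicalClosure)) :
    MulAction.fixedPoints G (StructureLattice G) = {0, infty G} := by
  refine fixedPoints_eq_of_forall_isOpen fun H hH hinf => ?_
  have key : ∀ U : Subgroup G, IsCompact (U : Set G) → IsOpen (U : Set G) →
      (Group.IsPerfect G ∨ Finite (U ⧸ (commutator U).topologicalClosure)) →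
        IsOpen (H.toSubgroup : Set G) := by
    intro U hUc hUo h
    obtain ⟨M, hMH, hMU, hUM⟩ := exists_rep_normalized hH hUc hUo
    have hbot : M.toSubgroup ≠ ⊥ := by
      intro h0
      refine hinf (mk_eq_zero_iff.mp (hMH.symm.trans (mk_eq_zero_iff.mpr ?_)))
      rw [h0]
      exact Set.finite_singleton _
    have hn : (M.toSubgroup.subgroupOf U).Normal :=
      (normal_subgroupOf_iff_le_normalizer hMU).mpr hUM
    have := finiteIndex_center_of_isCompactlyPresented hG (hMH ▸ hH) hbot hUc hUo hMU hUM
    have := finite_commutator_of_finiteIndex_center (Q := U ⧸ M.toSubgroup.subgroupOf U)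
    rw [← mk_eq_infty_iff, ← hMH, mk_eq_infty_iff]
    rcases h with h | h
    · exact isOpen_of_isPerfect (hMH ▸ hH) hbot hUo
    · exact isOpen_of_relIndex_ne_zero M.isCompact.isClosed hUo
        relIndex_ne_zero_of_finite_quotient
  rcases h with h | ⟨U, hUc, hUo, hU⟩
  · obtain ⟨U, hUc, hUo⟩ := exists_compactOpen G
    exact key U hUc hUo (.inl h)
  · exact key U hUc hUo (.inr hU)

end

end TDLC

theorem theoremD (G : Type*) [Group G] [TopologicalSpace G] [IsClassS G] :
    -- (i) some finite join of translates of any element is fixed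
    (∀ α : StructureLattice G, ∃ (n : ℕ) (g : Fin n → G) (β : StructureLattice G),
      1 ≤ n ∧ IsLUB (Set.range fun i => g i • α) β ∧
        β ∈ MulAction.fixedPoints G (StructureLattice G)) ∧
    -- (ii) no nontrivial fixed points: commensurated compact subgroups are finite or open
    (MulAction.fixedPoints G (StructureLattice G) = {0, StructureLattice.infty G} →
      ∀ K : Subgroup G, IsCompact (K : Set G) → Subgroup.Commensurable.commensurator K = ⊤ →
        (K : Set G).Finite ∨ IsOpen (K : Set G)) ∧
    -- (iii) abstract simplicity excludes nontrivial fixed points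
    (IsSimpleGroup G →
      MulAction.fixedPoints G (StructureLattice G) = {0, StructureLattice.infty G}) ∧
    -- (iv) compactly presented groups
    (IsCompactlyPresented G →
      (Group.IsPerfect G ∨
        ∃ U : Subgroup G, IsCompact (U : Set G) ∧ IsOpen (U : Set G) ∧
          Finite (U ⧸ (commutator U).topologicalClosure)) →
      MulAction.fixedPoints G (StructureLattice G) = {0, StructureLattice.infty G}) :=
  ⟨exists_isLUB_translates_mem_fixedPoints,
    fun hfix _ hKc hK => finite_or_isOpen_of_commensurated hfix hKc hK,
    fixedPoints_eq_of_isSimpleGroup, fixedPoints_eq_of_isCompactlyPresented⟩
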